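/- Fix an integer $d\ge 2$ and let $\xi_1,\dots,\xi_d$ be the standard orthonormal basis of $\mathbb{C}^d$. Let $q\in(-1,1)$. For $n\ge 0$ let $\mathcal{F}^{(q)}_n$ be the space $(\mathbb{C}^d)^{\otimes n}$ (with $(\mathbb{C}^d)^{\otimes 0}=\mathbb{C}\Omega$, $\|\Omega\|=1$) endowed with the positive definite inner product determined by $$\langle \xi_{i_1}\otimes\cdots\otimes\xi_{i_n},\ \xi_{j_1}\otimes\cdots\otimes\xi_{j_n}\rangle_q=\sum_{\sigma\in S_n}q^{\mathrm{inv}(\sigma)}\prod_{k=1}^n\delta_{i_k,j_{\sigma(k)}},\qquad \mathrm{inv}(\sigma)=\#\{(k,l): k<l,\ \sigma(k)>\sigma(l)\},$$ and let $\mathcal{F}_n$ be $(\mathbb{C}^d)^{\otimes n}$ with its usual inner product. Let $\mathcal{F}^{(q)}=\bigoplus_{n\ge0}\mathcal{F}^{(q)}_n$ and $\mathcal{F}=\bigoplus_{n\ge0}\mathcal{F}_n$ be the Hilbert space direct sums (the $q$-deformed Fock space and the full Fock space). For $1\le j\le d$ let $L^{(q)}_j\in B(\mathcal{F}^{(q)})$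 and $L_j\in B(\mathcal{F})$ be the left creation operators, i.e. the bounded operators acting on tensors by $\eta\mapsto\xi_j\otimes\eta$ (with $\Omega\mapsto\xi_j$), and put $$\mathcal{C}^{(q)}=C^*(L^{(q)}_1,\dots,L^{(q)}_d)\subseteq B(\mathcal{F}^{(q)}),\qquad \mathcal{C}=C^*(L_1,\dots,L_d)\subseteq B(\mathcal{F}),$$ so that $\mathcal{C}$ is the extended Cuntz algebra. Let $J^{(q)}$ on $\mathcal{F}^{(q)}$ and $J$ on $\mathcal{F}$ be the unitaries that fix $\Omega$ and reverse tensors, $\eta_1\otimes\cdots\otimes\eta_n\mapsto\eta_n\otimes\cdots\otimes\eta_1$. For $n\ge1$ let $M^{(q)}_n$ be the restriction to $\mathcal{F}^{(q)}_n$ of the positive operator $\sum_{j=1}^d L^{(q)}_j(L^{(q)}_j)^*$. The Dykema–Nica unitary is $U=\bigoplus_{n\ge0}U_n:\mathcal{F}^{(q)}\to\mathcal{F}$, where the unitaries $U_n:\mathcal{F}^{(q)}_n\to\mathcal{F}_n$ are defined recursively by $U_0\Omega=\Omega$ and $U_n=(I\otimes U_{n-1})(M^{(q)}_n)^{1/2}$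 for $n\ge1$. Let $U_{opp}=JUJ^{(q)}$, a unitary from $\mathcal{F}^{(q)}$ onto $\mathcal{F}$. **Theorem.** For every integer $d\ge2$ and every $q\in(-1,1)$, $$U_{opp}\,\mathcal{C}^{(q)}\,U_{opp}^*\subseteq\mathcal{C}.$$ -/

import Mathlib

namespace QFock

open scoped ComplexConjugate

/-! ### Permutations and the deformed inner product -/

/-- The number of inversions of a permutation: the number of pairs `i < j` with `σ i > σ j`. -/
def invCount {n : ℕ} (σ : Equiv.Perm (Fin n)) : ℕ :=
  (Finset.univ.filter fun p : Fin n × Fin n => p.1 < p.2 ∧ σ p.2 < σ p.1).card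

/-- The deformed inner product of the basis tensors `ξ_{v 0} ⊗ ⋯ ⊗ ξ_{v (n-1)}` and
`ξ_{w 0} ⊗ ⋯ ⊗ ξ_{w (n-1)}`. A word `v : Fin n → Fin d` indexes a basis tensor. -/
noncomputable def gram {d n : ℕ} (q : ℝ) (v w : Fin n → Fin d) : ℝ :=
  ∑ σ : Equiv.Perm (Fin n), q ^ invCount σ * ∏ k, if v k = w (σ k) then 1 else 0

theorem gram_eq {d n : ℕ} (q : ℝ) (v w : Fin n → Fin d) :
    gram q v w = ∑ σ : Equiv.Perm (Fin n), if v = w ∘ σ then q ^ invCount σ else 0 := by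
  unfold gram
  refine Finset.sum_congr rfl fun σ _ => ?_
  rw [Finset.prod_ite_zero]
  simp [funext_iff]

theorem inv_symm {n : ℕ} (σ : Equiv.Perm (Fin n)) : invCount σ⁻¹ = invCount σ := by
  unfold invCount
  refine Finset.card_bij' (fun p _ => (σ⁻¹ p.2, σ⁻¹ p.1)) (fun p _ => (σ p.2, σ p.1)) ?_ ?_ ?_ ?_
  all_goals simp +contextual

theorem gram_symm {d n : ℕ} (q : ℝ) (v w : Fin n → Fin d) : gram q v w = gram q w v := by
  rw [gram_eq, gram_eq]
  refine Fintype.sum_equiv (Equiv.inv _) _ _ fun σ => ?_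
  rw [Equiv.inv_apply, inv_symm]
  have : (v = w ∘ σ) ↔ (w = v ∘ ⇑σ⁻¹) := by
    constructor
    · rintro rfl; ext; simp
    · rintro rfl; ext; simp
  simp [this]

/-- The sesquilinear extension of `gram`: `x v` is the coefficient of `x` at the basis tensor
indexed by the word `v`. The form is conjugate-linear in the first variable. -/
noncomputable def form {d n : ℕ} (q : ℝ) (x y : (Fin n → Fin d) → ℂ) : ℂ :=
  ∑ v, ∑ w, conj (x v) * y w * gram q v w

theorem form_self {d n : ℕ} (q : ℝ) (x : (Fin n → Fin d) → ℂ) :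
    form q x x = ∑ σ : Equiv.Perm (Fin n), ∑ w, conj (x (w ∘ σ)) * x w * (q : ℂ) ^ invCount σ := by
  unfold form
  rw [Finset.sum_comm]
  conv_rhs => rw [Finset.sum_comm]
  refine Finset.sum_congr rfl fun w _ => ?_
  simp_rw [gram_eq]
  push_cast
  simp_rw [Finset.mul_sum]
  rw [Finset.sum_comm]
  refine Finset.sum_congr rfl fun σ _ => ?_
  rw [Finset.sum_eq_single (w ∘ σ)]
  · simp
  · intro b _ hb; simp [hb]
  · simp

/-- Whether a permutation keeps the order of a pair of values. -/
def sgn {n : ℕ} (p : Fin n × Fin n) (ρ : Equiv.Perm (Fin n)) : ℝ :=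
  if ρ.symm p.1 < ρ.symm p.2 then 1 else -1

theorem sgn_eq_iff {n : ℕ} (p : Fin n × Fin n) (ρ τ : Equiv.Perm (Fin n)) :
    sgn p ρ = sgn p τ ↔ (ρ.symm p.1 < ρ.symm p.2 ↔ τ.symm p.1 < τ.symm p.2) := by
  unfold sgn
  by_cases h : ρ.symm p.1 < ρ.symm p.2 <;> by_cases h' : τ.symm p.1 < τ.symm p.2 <;>
    simp only [h, h', if_true, if_false] <;> norm_num

theorem sgn_kernel {n : ℕ} (q : ℝ) (p : Fin n × Fin n) (ρ τ : Equiv.Perm (Fin n)) :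
    (1 + q) / 2 + (1 - q) / 2 * (sgn p ρ * sgn p τ) = if sgn p ρ = sgn p τ then 1 else q := by
  simp only [sgn_eq_iff]
  unfold sgn
  by_cases h : ρ.symm p.1 < ρ.symm p.2 <;> by_cases h' : τ.symm p.1 < τ.symm p.2 <;>
    simp only [h, h', if_true, if_false, iff_true, iff_false, not_true] <;> ring

/-- The pairs `a < b`. -/
def pairs (n : ℕ) : Finset (Fin n × Fin n) := Finset.univ.filter fun p => p.1 < p.2

theorem pow_inv_eq {n : ℕ} (q : ℝ) (ρ τ : Equiv.Perm (Fin n)) :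
    q ^ invCount (τ⁻¹ * ρ) = ∏ p ∈ pairs n, ((1 + q) / 2 + (1 - q) / 2 * (sgn p ρ * sgn p τ)) := by
  simp_rw [sgn_kernel]
  rw [Finset.prod_ite]
  simp only [Finset.prod_const_one, one_mul, Finset.prod_const]
  congr 1
  unfold invCount pairs
  have ne : ∀ (π : Equiv.Perm (Fin n)) {a b}, a ≠ b → π a ≠ π b := fun π a b h => by simpa using h
  refine Finset.card_bij' (fun p _ => if ρ p.1 < ρ p.2 then (ρ p.1, ρ p.2) else (ρ p.2, ρ p.1))
    (fun p _ => if ρ.symm p.1 < ρ.symm p.2 then (ρ.symm p.1, ρ.symm p.2)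
      else (ρ.symm p.2, ρ.symm p.1)) ?_ ?_ ?_ ?_
  · rintro ⟨i, j⟩ h
    rw [Finset.mem_filter] at h
    obtain ⟨-, h1, h2⟩ := h
    change i < j at h1
    change τ.symm (ρ j) < τ.symm (ρ i) at h2
    have := ne ρ h1.ne
    simp only [Finset.mem_filter, Finset.mem_univ, true_and, sgn_eq_iff]
    split_ifs with h3
    · simp [h1, h2.le, h3]
    · have h4 : ρ j < ρ i := by omega
      simp [h1.le, h2, h4]
  · rintro ⟨a, b⟩ h
    simp only [Finset.mem_filter, Finset.mem_univ, true_and, sgn_eq_iff] at h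
    obtain ⟨hab, h2⟩ := h
    have n1 := ne ρ.symm hab.ne
    have n2 := ne τ.symm hab.ne
    rw [Finset.mem_filter]
    refine ⟨Finset.mem_univ _, ?_⟩
    by_cases h3 : ρ.symm a < ρ.symm b
    · rw [if_pos h3]
      refine ⟨h3, ?_⟩
      change τ.symm (ρ (ρ.symm b)) < τ.symm (ρ (ρ.symm a))
      simp only [Equiv.apply_symm_apply]
      have : ¬ τ.symm a < τ.symm b := fun h => h2 ⟨fun _ => h, fun _ => h3⟩
      omega
    · rw [if_neg h3]
      refine ⟨show ρ.symm b < ρ.symm a by omega, ?_⟩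
      change τ.symm (ρ (ρ.symm a)) < τ.symm (ρ (ρ.symm b))
      simp only [Equiv.apply_symm_apply]
      by_contra h4
      exact h2 ⟨fun h => absurd h h3, fun h => absurd h h4⟩
  · rintro ⟨i, j⟩ h
    rw [Finset.mem_filter] at h
    have h1 : i < j := h.2.1
    by_cases h3 : ρ i < ρ j
    · simp [h3, h1]
    · simp [h3, h1.le]
  · rintro ⟨a, b⟩ h
    simp only [Finset.mem_filter, Finset.mem_univ, true_and] at h
    have h1 : a < b := h.1
    by_cases h3 : ρ.symm a < ρ.symm b
    · simp [h3, h1]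
    · simp [h3, h1.le]

/-- The Fourier weight of a set of pairs. -/
noncomputable def weight {n : ℕ} (q : ℝ) (S : Finset (Fin n × Fin n)) : ℝ :=
  ((1 + q) / 2) ^ ((pairs n) \ S).card * ((1 - q) / 2) ^ S.card

theorem pow_inv_eq_sum {n : ℕ} (q : ℝ) (ρ τ : Equiv.Perm (Fin n)) :
    q ^ invCount (τ⁻¹ * ρ) = ∑ S ∈ (pairs n).powerset,
      weight q S * ((∏ p ∈ S, sgn p ρ) * ∏ p ∈ S, sgn p τ) := by
  rw [pow_inv_eq]
  simp_rw [add_comm ((1 + q) / 2)]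
  rw [Finset.prod_add]
  refine Finset.sum_congr rfl fun S _ => ?_
  simp only [Finset.prod_mul_distrib, Finset.prod_const, weight]
  ring

/-- The Fourier coefficients of the orbit of a tensor. -/
noncomputable def coeff {d n : ℕ} (x : (Fin n → Fin d) → ℂ) (w : Fin n → Fin d)
    (S : Finset (Fin n × Fin n)) : ℂ :=
  ∑ τ : Equiv.Perm (Fin n), x (w ∘ τ) * ((∏ p ∈ S, sgn p τ : ℝ) : ℂ)

theorem form_self_eq {d n : ℕ} (q : ℝ) (x : (Fin n → Fin d) → ℂ) :
    (n.factorial : ℂ) * form q x x =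
      ((∑ w, ∑ S ∈ (pairs n).powerset, weight q S * Complex.normSq (coeff x w S) : ℝ) : ℂ) := by
  have h1 : ∀ τ : Equiv.Perm (Fin n), form q x x =
      ∑ ρ : Equiv.Perm (Fin n), ∑ w, conj (x (w ∘ ρ)) * x (w ∘ τ) * ((q ^ invCount (τ⁻¹ * ρ) : ℝ) : ℂ) := by
    intro τ
    rw [form_self]
    refine Fintype.sum_equiv (Equiv.mulLeft τ) _ _ fun σ => ?_
    refine Fintype.sum_equiv (Equiv.arrowCongr τ (Equiv.refl _)) _ _ fun w => ?_
    have e1 : ((Equiv.arrowCongr τ (Equiv.refl (Fin d))) w) ∘ ⇑τ = w := by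
      ext; simp [Equiv.arrowCongr]
    rw [Equiv.coe_mulLeft, inv_mul_cancel_left, Equiv.Perm.coe_mul, ← Function.comp_assoc, e1]
    push_cast
    rfl
  have h2 : (n.factorial : ℂ) * form q x x = ∑ τ : Equiv.Perm (Fin n), form q x x := by
    simp [Fintype.card_perm]
  rw [h2, Finset.sum_congr rfl fun τ _ => h1 τ]
  simp_rw [pow_inv_eq_sum]
  have h3 : ∀ w S, (weight q S : ℂ) * (Complex.normSq (coeff x w S) : ℂ) =
      ∑ τ : Equiv.Perm (Fin n), ∑ ρ : Equiv.Perm (Fin n), conj (x (w ∘ ρ)) * x (w ∘ τ) *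
        ((weight q S * ((∏ p ∈ S, sgn p ρ) * ∏ p ∈ S, sgn p τ) : ℝ) : ℂ) := by
    intro w S
    rw [← Complex.mul_conj, coeff, map_sum, Finset.sum_mul_sum, Finset.mul_sum]
    refine Finset.sum_congr rfl fun τ _ => ?_
    rw [Finset.mul_sum]
    refine Finset.sum_congr rfl fun ρ _ => ?_
    rw [map_mul, Complex.conj_ofReal, Complex.ofReal_mul, Complex.ofReal_mul]
    ring
  simp_rw [Complex.ofReal_sum, Complex.ofReal_mul (weight _ _) (Complex.normSq _), h3,
    Finset.mul_sum]
  calc _ = ∑ τ : Equiv.Perm (Fin n), ∑ w, ∑ ρ : Equiv.Perm (Fin n),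
        ∑ S ∈ (pairs n).powerset, conj (x (w ∘ ρ)) * x (w ∘ τ) *
        ((weight q S * ((∏ p ∈ S, sgn p ρ) * ∏ p ∈ S, sgn p τ) : ℝ) : ℂ) :=
        Finset.sum_congr rfl fun τ _ => Finset.sum_comm
    _ = ∑ w, ∑ τ : Equiv.Perm (Fin n), ∑ ρ : Equiv.Perm (Fin n),
        ∑ S ∈ (pairs n).powerset, conj (x (w ∘ ρ)) * x (w ∘ τ) *
        ((weight q S * ((∏ p ∈ S, sgn p ρ) * ∏ p ∈ S, sgn p τ) : ℝ) : ℂ) := Finset.sum_comm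
    _ = _ := by
      refine Finset.sum_congr rfl fun w _ => ?_
      rw [Finset.sum_comm]
      refine Eq.trans ?_ Finset.sum_comm
      rw [Finset.sum_comm]
      refine Finset.sum_congr rfl fun τ _ => Finset.sum_comm

theorem weight_pos {n : ℕ} {q : ℝ} (h : q ∈ Set.Ioo (-1 : ℝ) 1) (S : Finset (Fin n × Fin n)) :
    0 < weight q S :=
  mul_pos (pow_pos (by linarith [h.1]) _) (pow_pos (by linarith [h.2]) _)

theorem coeff_injective {d n : ℕ} {x : (Fin n → Fin d) → ℂ} {w : Fin n → Fin d}
    (h : ∀ S ∈ (pairs n).powerset, coeff x w S = 0) : x w = 0 := by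
  have h1 : ∑ S ∈ (pairs n).powerset, coeff x w S * ((∏ p ∈ S, sgn p 1 : ℝ) : ℂ) = 0 :=
    Finset.sum_eq_zero fun S hS => by rw [h S hS, zero_mul]
  have h2 : ∀ τ : Equiv.Perm (Fin n), ∑ S ∈ (pairs n).powerset,
      (∏ p ∈ S, sgn p τ) * (∏ p ∈ S, sgn p 1) = if τ = 1 then (2 : ℝ) ^ (pairs n).card else 0 := by
    intro τ
    have h3 : ∑ S ∈ (pairs n).powerset, (∏ p ∈ S, sgn p τ) * (∏ p ∈ S, sgn p 1) =
        ∏ p ∈ pairs n, (sgn p τ * sgn p 1 + 1) := by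
      rw [Finset.prod_add]
      exact Finset.sum_congr rfl fun S _ => by simp [Finset.prod_mul_distrib]
    rw [h3]
    split_ifs with ht
    · subst ht
      rw [← Finset.prod_const]
      refine Finset.prod_congr rfl fun p hp => ?_
      unfold sgn; split_ifs <;> norm_num
    · have : ∃ p ∈ pairs n, sgn p τ ≠ sgn p 1 := by
        by_contra hc
        push Not at hc
        apply ht
        have hm : StrictMono τ.symm := by
          intro a b hab
          have := (sgn_eq_iff _ _ _).1 (hc (a, b) (by simp [pairs, hab]))
          exact this.2 hab
        ext a
        have := congrArg τ (le_antisymm (hm.le_id a) (hm.id_le a))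
        simpa using congrArg Fin.val this.symm
      obtain ⟨p, hp, hne⟩ := this
      refine Finset.prod_eq_zero hp ?_
      rw [Ne, sgn_eq_iff] at hne
      unfold sgn
      split_ifs <;> simp_all
  simp_rw [coeff, Finset.sum_mul] at h1
  rw [Finset.sum_comm] at h1
  have h4 : ∀ τ : Equiv.Perm (Fin n), ∑ S ∈ (pairs n).powerset,
      x (w ∘ τ) * ((∏ p ∈ S, sgn p τ : ℝ) : ℂ) * ((∏ p ∈ S, sgn p 1 : ℝ) : ℂ) =
      x (w ∘ τ) * ((if τ = 1 then (2 : ℝ) ^ (pairs n).card else 0 : ℝ) : ℂ) := by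
    intro τ
    rw [← h2 τ, Complex.ofReal_sum, Finset.mul_sum]
    exact Finset.sum_congr rfl fun S _ => by rw [Complex.ofReal_mul]; ring
  simp_rw [h4] at h1
  rw [Finset.sum_eq_single 1 (fun τ _ ht => by simp [ht]) (by simp)] at h1
  simpa using h1

theorem form_self_nonneg {d n : ℕ} {q : ℝ} (h : q ∈ Set.Ioo (-1 : ℝ) 1)
    (x : (Fin n → Fin d) → ℂ) : 0 ≤ (form q x x).re := by
  have h1 := congrArg Complex.re (form_self_eq q x)
  rw [Complex.ofReal_re, ← Complex.ofReal_natCast, Complex.re_ofReal_mul] at h1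
  have h2 : 0 ≤ (n.factorial : ℝ) * (form q x x).re := by
    rw [h1]
    exact Finset.sum_nonneg fun w _ => Finset.sum_nonneg fun S _ =>
      mul_nonneg (weight_pos h S).le (Complex.normSq_nonneg _)
  exact nonneg_of_mul_nonneg_right h2 (by positivity)

theorem form_definite {d n : ℕ} {q : ℝ} (h : q ∈ Set.Ioo (-1 : ℝ) 1)
    (x : (Fin n → Fin d) → ℂ) (hx : form q x x = 0) : x = 0 := by
  have h1 := form_self_eq q x
  rw [hx, mul_zero, eq_comm, Complex.ofReal_eq_zero,
    Finset.sum_eq_zero_iff_of_nonneg fun w _ => Finset.sum_nonneg fun S _ =>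
      mul_nonneg (weight_pos h S).le (Complex.normSq_nonneg _)] at h1
  funext w
  refine coeff_injective fun S hS => ?_
  have h2 := h1 w (Finset.mem_univ _)
  rw [Finset.sum_eq_zero_iff_of_nonneg fun S _ =>
      mul_nonneg (weight_pos h S).le (Complex.normSq_nonneg _)] at h2
  have h3 := h2 S hS
  rw [mul_eq_zero, Complex.normSq_eq_zero] at h3
  exact h3.resolve_left (weight_pos h S).ne'

theorem inv_eq_sum {n : ℕ} (σ : Equiv.Perm (Fin n)) :
    invCount σ = ∑ i, ∑ j, if i < j ∧ σ j < σ i then 1 else 0 := by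
  unfold invCount
  rw [Finset.card_filter, Fintype.sum_prod_type]

/-- The permutation of `Fin (n + 1)` with `0 ↦ m` that induces `σ` on the remaining points. -/
def extend {n : ℕ} (m : Fin (n + 1)) (σ : Equiv.Perm (Fin n)) : Equiv.Perm (Fin (n + 1)) :=
  (finSuccEquiv' 0).trans ((Equiv.optionCongr σ).trans (finSuccEquiv' m).symm)

theorem extend_zero {n : ℕ} (m : Fin (n + 1)) (σ : Equiv.Perm (Fin n)) : extend m σ 0 = m := by
  simp [extend]

theorem extend_succ {n : ℕ} (m : Fin (n + 1)) (σ : Equiv.Perm (Fin n)) (k : Fin n) :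
    extend m σ k.succ = m.succAbove (σ k) := by
  have : finSuccEquiv' (0 : Fin (n + 1)) k.succ = some k := by
    rw [← Fin.succAbove_zero_apply, finSuccEquiv'_succAbove]
  simp [extend, this]

theorem extend_bijective (n : ℕ) : Function.Bijective
    (fun p : Fin (n + 1) × Equiv.Perm (Fin n) => extend p.1 p.2) := by
  rw [Fintype.bijective_iff_injective_and_card]
  constructor
  · rintro ⟨m, σ⟩ ⟨m', σ'⟩ h
    simp only at h
    have h0 : m = m' := by rw [← extend_zero m σ, h, extend_zero]
    subst h0
    have h1 : σ = σ' := by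
      ext k
      have := congrArg (fun π => π k.succ) h
      simp only [extend_succ] at this
      rw [Fin.succAbove_right_injective this]
    rw [h1]
  · simp [Fintype.card_perm, Nat.factorial_succ]

theorem inv_extend {n : ℕ} (m : Fin (n + 1)) (σ : Equiv.Perm (Fin n)) :
    invCount (extend m σ) = m + invCount σ := by
  rw [inv_eq_sum, inv_eq_sum, Fin.sum_univ_succ]
  congr 1
  · rw [Fin.sum_univ_succ]
    simp only [extend_zero, extend_succ, lt_self_iff_false, false_and, if_false, Fin.succ_pos,
      true_and, zero_add]
    rw [Equiv.sum_comp σ (fun k => if m.succAbove k < m then 1 else 0)]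
    simp only [Fin.succAbove_lt_iff_castSucc_lt]
    rw [← Finset.card_filter]
    have := Fin.card_filter_val_lt (n := n) (m := (m : ℕ))
    simp only [Fin.lt_def, Fin.val_castSucc]
    rw [this]; omega
  · refine Finset.sum_congr rfl fun i _ => ?_
    rw [Fin.sum_univ_succ]
    simp [extend_succ]

theorem gram_cons {d n : ℕ} (q : ℝ) (j : Fin d) (v : Fin n → Fin d) (w : Fin (n + 1) → Fin d) :
    gram q (Fin.cons j v : Fin (n + 1) → Fin d) w =
      ∑ m : Fin (n + 1), if w m = j then q ^ (m : ℕ) * gram q v (m.removeNth w) else 0 := by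
  unfold gram
  rw [← (Equiv.ofBijective _ (extend_bijective n)).sum_comp, Fintype.sum_prod_type]
  refine Finset.sum_congr rfl fun m _ => ?_
  simp only [Equiv.ofBijective_apply, inv_extend, Fin.prod_univ_succ, extend_zero, extend_succ,
    Fin.cons_zero, Fin.cons_succ, Fin.removeNth]
  by_cases h : w m = j
  · simp only [h, if_true, one_mul, Finset.mul_sum, pow_add, mul_assoc]
    rfl
  · simp [h, Ne.symm h]

theorem inv_rev {n : ℕ} (σ : Equiv.Perm (Fin n)) :
    invCount (Fin.revPerm.trans (σ.trans Fin.revPerm)) = invCount σ := by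
  unfold invCount
  refine Finset.card_bij' (fun p _ => (p.2.rev, p.1.rev)) (fun p _ => (p.2.rev, p.1.rev)) ?_ ?_ ?_ ?_
  all_goals simp +contextual

theorem gram_rev {d n : ℕ} (q : ℝ) (v w : Fin n → Fin d) :
    gram q (v ∘ Fin.rev) (w ∘ Fin.rev) = gram q v w := by
  rw [gram_eq, gram_eq]
  have hbij : Function.Bijective
      (fun σ : Equiv.Perm (Fin n) => Fin.revPerm.trans (σ.trans Fin.revPerm)) := by
    refine Function.Involutive.bijective fun σ => ?_
    ext; simp
  refine Fintype.sum_bijective _ hbij _ _ fun σ => ?_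
  have : v ∘ Fin.rev = (w ∘ Fin.rev) ∘ σ ↔
      v = w ∘ (Fin.revPerm.trans (σ.trans Fin.revPerm)) := by
    constructor
    · intro h; ext k
      have := congrFun h k.rev
      simp at this
      simp [this]
    · intro h; subst h; ext k; simp
  simp only [this, inv_rev]


/-! ### The graded pieces -/

theorem form_add_left {d n : ℕ} (q : ℝ) (x y z : (Fin n → Fin d) → ℂ) :
    form q (x + y) z = form q x z + form q y z := by
  simp only [form, Pi.add_apply, map_add, add_mul, Finset.sum_add_distrib]

theorem form_smul_left {d n : ℕ} (q : ℝ) (x y : (Fin n → Fin d) → ℂ) (r : ℂ) :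
    form q (r • x) y = conj r * form q x y := by
  simp only [form, Pi.smul_apply, smul_eq_mul, map_mul, Finset.mul_sum, mul_assoc]

theorem form_conj_symm {d n : ℕ} (q : ℝ) (x y : (Fin n → Fin d) → ℂ) :
    conj (form q y x) = form q x y := by
  simp only [form, map_sum, map_mul, Complex.conj_conj, Complex.conj_ofReal]
  rw [Finset.sum_comm]
  refine Finset.sum_congr rfl fun v _ => Finset.sum_congr rfl fun w _ => ?_
  rw [gram_symm]; ring

/-- The Hilbert space of `n`-tensors over `ℂ^d` with the deformed inner product `form q`, a tensor
being given by its coordinates in the basis of words. For `n = 0` there is one word, the vacuum. -/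
def QTensor (d : ℕ) (_q : Set.Ioo (-1 : ℝ) 1) (n : ℕ) : Type := (Fin n → Fin d) → ℂ

section

variable (d : ℕ) (q : Set.Ioo (-1 : ℝ) 1) (n : ℕ)

/-- The deformed inner product, with the proof that it is positive definite. -/
@[reducible]
noncomputable def qCore : InnerProductSpace.Core ℂ ((Fin n → Fin d) → ℂ) where
  inner x y := form q.1 x y
  conj_inner_symm x y := form_conj_symm q.1 x y
  re_inner_nonneg x := form_self_nonneg q.2 x
  add_left x y z := form_add_left q.1 x y z
  smul_left x y r := form_smul_left q.1 x y r
  definite x h := form_definite q.2 x h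

noncomputable instance : NormedAddCommGroup (QTensor d q n) := (qCore d q n).toNormedAddCommGroup

noncomputable instance : InnerProductSpace ℂ (QTensor d q n) :=
  InnerProductSpace.ofCore (qCore d q n).toCore

noncomputable instance : Inner ℂ (QTensor d q n) := InnerProductSpace.toInner

instance : FiniteDimensional ℂ (QTensor d q n) :=
  inferInstanceAs (FiniteDimensional ℂ ((Fin n → Fin d) → ℂ))

/-- The coordinates of a tensor in the basis of words. -/
noncomputable def qCoord : QTensor d q n ≃ₗ[ℂ] ((Fin n → Fin d) → ℂ) where
  toFun x := x
  map_add' _ _ := rfl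
  map_smul' _ _ := rfl
  invFun x := x
  left_inv _ := rfl
  right_inv _ := rfl

instance : CompleteSpace (QTensor d q n) := FiniteDimensional.complete ℂ _

end

theorem inner_eq_form {d n : ℕ} {q : Set.Ioo (-1 : ℝ) 1} (x y : QTensor d q n) :
    inner ℂ x y = form q.1 x y := rfl

/-- The Hilbert space of `n`-tensors over `ℂ^d` with the usual inner product, for which the basis
of words is orthonormal. -/
abbrev FTensor (d n : ℕ) : Type := EuclideanSpace ℂ (Fin n → Fin d)

/-- The deformed Fock space: the Hilbert direct sum of the deformed spaces of `n`-tensors. -/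
abbrev QFockSpace (d : ℕ) (q : Set.Ioo (-1 : ℝ) 1) : Type := lp (fun n => QTensor d q n) 2

/-- The full Fock space: the Hilbert direct sum of the spaces of `n`-tensors. -/
abbrev FockSpace (d : ℕ) : Type := lp (fun n => FTensor d n) 2

/-! ### Operators on a Hilbert direct sum given by blocks -/

section Blocks

variable {G H : ℕ → Type} [∀ n, NormedAddCommGroup (G n)] [∀ n, InnerProductSpace ℂ (G n)]
  [∀ n, NormedAddCommGroup (H n)] [∀ n, InnerProductSpace ℂ (H n)]

/-- The direct sum of a sequence of unitaries. -/
noncomputable def sumUnitary (e : ∀ n, G n ≃ₗᵢ[ℂ] H n) : lp G 2 ≃ₗᵢ[ℂ] lp H 2 where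
  toFun x := ⟨fun n => e n (x n), (lp.memℓp x).mono' fun n => ((e n).norm_map _).le⟩
  map_add' x y := by ext n; exact map_add (e n) (x n) (y n)
  map_smul' c x := by ext n; simp
  invFun y := ⟨fun n => (e n).symm (y n), (lp.memℓp y).mono' fun n => ((e n).symm.norm_map _).le⟩
  left_inv x := by ext n; simp
  right_inv y := by ext n; simp
  norm_map' x := by
    simp [lp.norm_eq_tsum_rpow (p := 2) (by norm_num)]

/-- The action of a sequence of maps `G n → G (n + 1)` on sequences of vectors. -/
def raiseFun (T : ∀ n, G n →L[ℂ] G (n + 1)) (x : ∀ n, G n) : ∀ n, G n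
  | 0 => 0
  | n + 1 => T n (x n)

/-- The operator with blocks `T n : G n → G (n + 1)`, for a bounded sequence `T`. -/
noncomputable def raise (T : ∀ n, G n →L[ℂ] G (n + 1)) (C : ℝ) (hC : ∀ n, ‖T n‖ ≤ C) :
    lp G 2 →L[ℂ] lp G 2 :=
  have hs : ∀ x : lp G 2, HasSum (fun n => (C * ‖x n‖) ^ 2) ((C * ‖x‖) ^ 2) := fun x => by
    have := (lp.hasSum_norm (p := 2) (by norm_num) x).mul_left (C ^ 2)
    simpa [mul_pow] using this
  have hle : ∀ (x : lp G 2) n, ‖raiseFun T x (n + 1)‖ ^ 2 ≤ (C * ‖x n‖) ^ 2 := fun x n =>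
    pow_le_pow_left₀ (norm_nonneg _) ((T n).le_of_opNorm_le (hC n) (x n)) 2
  have hsum : ∀ x : lp G 2, Summable fun n => ‖raiseFun T x n‖ ^ 2 := fun x =>
    (summable_nat_add_iff 1).1
      (Summable.of_nonneg_of_le (fun n => by positivity) (hle x) (hs x).summable)
  LinearMap.mkContinuous
    { toFun := fun x => ⟨raiseFun T x, memℓp_gen (by simpa using hsum x)⟩
      map_add' := fun x y => by
        ext n
        cases n with
        | zero => exact (add_zero (0 : G 0)).symm
        | succ n => exact map_add (T n) (x n) (y n)
      map_smul' := fun c x => by ext n; cases n <;> simp [raiseFun] }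
    C fun x => by
      have hC0 : 0 ≤ C := (norm_nonneg _).trans (hC 0)
      refine lp.norm_le_of_tsum_le (by norm_num) (by positivity) ?_
      have h1 : ∑' n, ‖raiseFun T x n‖ ^ 2 ≤ (C * ‖x‖) ^ 2 := by
        rw [(hsum x).tsum_eq_zero_add, ← (hs x).tsum_eq]
        simpa [raiseFun] using ((summable_nat_add_iff 1).2 (hsum x)).tsum_le_tsum (hle x)
          (hs x).summable
      simpa using h1

end Blocks

/-! ### Creation operators, reversal of tensors, and the unitary of Dykema and Nica -/

/-- Tensoring with the `j`-th basis vector from the left, `x ↦ ξ_j ⊗ x`, in coordinates. -/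
def consMap (d : ℕ) (j : Fin d) (n : ℕ) :
    ((Fin n → Fin d) → ℂ) →ₗ[ℂ] ((Fin (n + 1) → Fin d) → ℂ) where
  toFun x w := if w 0 = j then x (Fin.tail w) else 0
  map_add' x y := by ext w; by_cases h : w 0 = j <;> simp [h]
  map_smul' c x := by ext w; by_cases h : w 0 = j <;> simp [h]

/-- The formula for the annihilation operator, in coordinates. -/
noncomputable def ann {d : ℕ} (q : ℝ) (j : Fin d) {n : ℕ} (x : (Fin (n + 1) → Fin d) → ℂ) :
    (Fin n → Fin d) → ℂ :=
  fun v => ∑ m : Fin (n + 1), (q : ℂ) ^ (m : ℕ) * x (m.insertNth j v)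

theorem form_cons {d n : ℕ} (q : ℝ) (j : Fin d) (x : (Fin n → Fin d) → ℂ)
    (y : (Fin (n + 1) → Fin d) → ℂ) : form q (consMap d j n x) y = form q x (ann q j y) := by
  have h1 : form q (consMap d j n x) y =
      ∑ v : Fin n → Fin d, ∑ w, conj (x v) * y w * gram q (Fin.cons j v : Fin (n + 1) → Fin d) w := by
    unfold form
    rw [← (Fin.consEquiv fun _ : Fin (n + 1) => Fin d).sum_comp, Fintype.sum_prod_type,
      Finset.sum_eq_single j]
    · simp [consMap, Fin.consEquiv]
    · intro b _ hb; simp [consMap, Fin.consEquiv, hb]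
    · simp
  rw [h1]
  unfold form ann
  refine Finset.sum_congr rfl fun v _ => ?_
  simp_rw [gram_cons, Complex.ofReal_sum, Finset.mul_sum, Finset.sum_mul]
  rw [Finset.sum_comm]
  conv_rhs => rw [Finset.sum_comm]
  refine Finset.sum_congr rfl fun m _ => ?_
  rw [← (Fin.insertNthEquiv (fun _ : Fin (n + 1) => Fin d) m).sum_comp, Fintype.sum_prod_type,
    Finset.sum_eq_single j]
  · refine Finset.sum_congr rfl fun w _ => ?_
    simp [Fin.insertNthEquiv]
    ring
  · intro b _ hb; simp [Fin.insertNthEquiv, hb]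
  · simp

theorem ann_cons_zero {d : ℕ} (q : ℝ) (j : Fin d) (x : (Fin 0 → Fin d) → ℂ) :
    ann q j (consMap d j 0 x) = x := by
  funext v
  simp [ann, consMap]

theorem ann_cons_succ {d n : ℕ} (q : ℝ) (j : Fin d) (x : (Fin (n + 1) → Fin d) → ℂ) :
    ann q j (consMap d j (n + 1) x) = x + (q : ℂ) • consMap d j n (ann q j x) := by
  funext v
  unfold ann
  rw [Fin.sum_univ_succ]
  congr 1
  · simp [consMap]
  · obtain ⟨i, v, rfl⟩ : ∃ i u, v = (Fin.cons i u : Fin (n + 1) → Fin d) :=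
      ⟨v 0, Fin.tail v, (Fin.cons_self_tail v).symm⟩
    have : ∀ m : Fin (n + 1), (Fin.insertNth m.succ j (Fin.cons i v : Fin (n + 1) → Fin d) :
        Fin (n + 2) → Fin d) = Fin.cons i (Fin.insertNth m j v : Fin (n + 1) → Fin d) := by
      intro m
      exact Fin.insertNth_succ_cons m j i v
    simp only [consMap, this, LinearMap.coe_mk, AddHom.coe_mk, Fin.cons_zero, Fin.tail_cons,
      Pi.smul_apply, smul_eq_mul, Fin.val_succ, pow_succ]
    by_cases h : i = j
    · simp only [h, if_true, Finset.mul_sum]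
      exact Finset.sum_congr rfl fun m _ => by ring
    · simp [h]

section

variable (d : ℕ) (q : Set.Ioo (-1 : ℝ) 1)

/-- The `n`-th block of the deformed left creation operator. -/
noncomputable def qCreateBlock (j : Fin d) (n : ℕ) : QTensor d q n →L[ℂ] QTensor d q (n + 1) :=
  LinearMap.toContinuousLinearMap
    ((qCoord d q (n + 1)).symm.toLinearMap ∘ₗ consMap d j n ∘ₗ (qCoord d q n).toLinearMap)

variable {d q}

theorem qCreateBlock_apply (j : Fin d) (n : ℕ) (x : QTensor d q n) :
    qCreateBlock d q j n x = consMap d j n x := rfl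

theorem adjoint_qCreateBlock (j : Fin d) (n : ℕ) (x : QTensor d q (n + 1)) :
    ContinuousLinearMap.adjoint (qCreateBlock d q j n) x = ann q.1 j x := by
  refine ext_inner_left ℂ fun y => ?_
  rw [ContinuousLinearMap.adjoint_inner_right]
  exact form_cons q.1 j y x

theorem norm_qCreateBlock_le (j : Fin d) (n : ℕ) :
    ‖qCreateBlock d q j n‖ ≤ √(1 - |q.1|)⁻¹ := by
  have hq : 0 < 1 - |q.1| := by rw [sub_pos, abs_lt]; exact q.2
  have hK : (√(1 - |q.1|)⁻¹) ^ 2 = (1 - |q.1|)⁻¹ := Real.sq_sqrt (by positivity)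
  have hK1 : 1 + |q.1| * (1 - |q.1|)⁻¹ = (1 - |q.1|)⁻¹ := by field_simp; ring
  induction n with
  | zero =>
    refine ContinuousLinearMap.opNorm_le_bound _ (Real.sqrt_nonneg _) fun x => ?_
    refine le_of_sq_le_sq ?_ (by positivity)
    have h : ‖qCreateBlock d q j 0 x‖ ^ 2 = ‖x‖ ^ 2 := by
      rw [← @inner_self_eq_norm_sq ℂ, ← @inner_self_eq_norm_sq ℂ,
        ← ContinuousLinearMap.adjoint_inner_right, adjoint_qCreateBlock]
      exact congrArg (fun y : QTensor d q 0 => RCLike.re (inner ℂ x y)) (ann_cons_zero q.1 j x)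
    rw [h, mul_pow, hK]
    have : 1 ≤ (1 - |q.1|)⁻¹ := by rw [← hK1]; linarith [show 0 ≤ |q.1| * (1 - |q.1|)⁻¹ by positivity]
    nlinarith [sq_nonneg ‖x‖]
  | succ n ih =>
    refine ContinuousLinearMap.opNorm_le_bound _ (Real.sqrt_nonneg _) fun x => ?_
    refine le_of_sq_le_sq ?_ (by positivity)
    have h : ‖qCreateBlock d q j (n + 1) x‖ ^ 2 = ‖x‖ ^ 2 +
        q.1 * ‖ContinuousLinearMap.adjoint (qCreateBlock d q j n) x‖ ^ 2 := by
      have h1 : ContinuousLinearMap.adjoint (qCreateBlock d q j (n + 1))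
          (qCreateBlock d q j (n + 1) x) = x + (q.1 : ℂ) •
          qCreateBlock d q j n (ContinuousLinearMap.adjoint (qCreateBlock d q j n) x) := by
        rw [adjoint_qCreateBlock, adjoint_qCreateBlock]
        exact ann_cons_succ q.1 j x
      rw [← @inner_self_eq_norm_sq ℂ, ← @inner_self_eq_norm_sq ℂ, ← @inner_self_eq_norm_sq ℂ,
        ← ContinuousLinearMap.adjoint_inner_right, h1, inner_add_right, inner_smul_right,
        ← ContinuousLinearMap.adjoint_inner_left, map_add]
      congr 1
      exact Complex.re_ofReal_mul _ _
    have h2 : ‖ContinuousLinearMap.adjoint (qCreateBlock d q j n) x‖ ^ 2 ≤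
        (1 - |q.1|)⁻¹ * ‖x‖ ^ 2 := by
      rw [← hK, ← mul_pow]
      refine pow_le_pow_left₀ (norm_nonneg _) (ContinuousLinearMap.le_of_opNorm_le _ ?_ x) 2
      rwa [LinearIsometryEquiv.norm_map]
    rw [h, mul_pow, hK]
    calc _ ≤ ‖x‖ ^ 2 + |q.1| * ((1 - |q.1|)⁻¹ * ‖x‖ ^ 2) := by
          gcongr
          exact le_abs_self _
      _ = (1 + |q.1| * (1 - |q.1|)⁻¹) * ‖x‖ ^ 2 := by ring
      _ = _ := by rw [hK1]

variable (d q)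

/-- The deformed left creation operator: it sends the tensor with index word `w` to the one with
index word `j w`. -/
noncomputable def qCreate (j : Fin d) : QFockSpace d q →L[ℂ] QFockSpace d q :=
  raise (qCreateBlock d q j) (√(1 - |q.1|)⁻¹) (norm_qCreateBlock_le j)

/-- The `C*`-algebra generated by the deformed left creation operators: the norm closure of the
`*`-algebra that they generate. (The identity is `L_j* L_j - q L_j L_j*`, so for `d ≥ 1` taking the
unital `*`-algebra makes no difference.) -/
noncomputable def qCuntz : StarSubalgebra ℂ (QFockSpace d q →L[ℂ] QFockSpace d q) :=
  (StarAlgebra.adjoin ℂ (Set.range (qCreate d q))).topologicalClosure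

/-- The `n`-th block of the left creation operator. -/
noncomputable def createBlock (j : Fin d) (n : ℕ) : FTensor d n →L[ℂ] FTensor d (n + 1) :=
  LinearMap.toContinuousLinearMap ((WithLp.linearEquiv 2 ℂ _).symm.toLinearMap ∘ₗ consMap d j n ∘ₗ
    (WithLp.linearEquiv 2 ℂ _).toLinearMap)

theorem norm_createBlock_le {d : ℕ} (j : Fin d) (n : ℕ) : ‖createBlock d j n‖ ≤ 1 := by
  refine ContinuousLinearMap.opNorm_le_bound _ zero_le_one fun x => ?_
  rw [one_mul]
  refine le_of_sq_le_sq ?_ (by positivity)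
  rw [EuclideanSpace.norm_sq_eq, EuclideanSpace.norm_sq_eq,
    ← (Fin.consEquiv fun _ : Fin (n + 1) => Fin d).sum_comp, Fintype.sum_prod_type,
    Finset.sum_eq_single j]
  · simp [createBlock, consMap, Fin.consEquiv]
  · intro b _ hb; simp [createBlock, consMap, Fin.consEquiv, hb]
  · simp

/-- The left creation operator on the full Fock space. -/
noncomputable def create (j : Fin d) : FockSpace d →L[ℂ] FockSpace d :=
  raise (createBlock d j) 1 (norm_createBlock_le j)

/-- The `C*`-algebra generated by the left creation operators (the extended Cuntz algebra). -/
noncomputable def cuntz : StarSubalgebra ℂ (FockSpace d →L[ℂ] FockSpace d) :=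
  (StarAlgebra.adjoin ℂ (Set.range (create d))).topologicalClosure

/-- The reversal of words, `w ↦ w ∘ rev`. -/
def revWord (n : ℕ) : (Fin n → Fin d) ≃ (Fin n → Fin d) :=
  Equiv.arrowCongr Fin.revPerm (Equiv.refl _)

theorem form_rev {d n : ℕ} (q : ℝ) (x y : (Fin n → Fin d) → ℂ) :
    form q (x ∘ revWord d n) (y ∘ revWord d n) = form q x y := by
  unfold form
  refine Fintype.sum_equiv (revWord d n) _ _ fun v => ?_
  refine Fintype.sum_equiv (revWord d n) _ _ fun w => ?_
  rw [show revWord d n v = v ∘ Fin.rev from rfl, show revWord d n w = w ∘ Fin.rev from rfl, gram_rev]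
  rfl

/-- The reversal of the order of the components of a tensor, on the `n`-th deformed piece. -/
noncomputable def qReverseBlock (n : ℕ) : QTensor d q n ≃ₗᵢ[ℂ] QTensor d q n where
  toLinearEquiv := (qCoord d q n).trans
    ((LinearEquiv.funCongrLeft ℂ ℂ (revWord d n)).trans (qCoord d q n).symm)
  norm_map' x := by
    rw [← sq_eq_sq₀ (norm_nonneg _) (norm_nonneg _), ← @inner_self_eq_norm_sq ℂ,
      ← @inner_self_eq_norm_sq ℂ]
    exact congrArg _ (form_rev q.1 x x)

/-- The unitary reversal of tensors on the deformed Fock space. -/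
noncomputable def qReverse : QFockSpace d q ≃ₗᵢ[ℂ] QFockSpace d q := sumUnitary (qReverseBlock d q)

/-- The unitary reversal of tensors on the full Fock space. -/
noncomputable def reverse : FockSpace d ≃ₗᵢ[ℂ] FockSpace d :=
  sumUnitary fun n => LinearIsometryEquiv.piLpCongrLeft 2 ℂ ℂ (revWord d n)

/-- The block `M_{n+1}` on the `(n + 1)`-tensors of the operator `M = ∑ j, L_j L_j*`, where `L_j` are
the deformed left creation operators. -/
noncomputable def qM (n : ℕ) : QTensor d q (n + 1) →L[ℂ] QTensor d q (n + 1) :=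
  ∑ j, qCreateBlock d q j n ∘L ContinuousLinearMap.adjoint (qCreateBlock d q j n)

variable {d q}

/-- The component `y_j` of a tensor `∑ j, ξ_j ⊗ y_j`. -/
def component {n : ℕ} (j : Fin d) (x : QTensor d q (n + 1)) : QTensor d q n :=
  fun v => x (Fin.cons j v)

/-- The map `I ⊗ V`, which sends `∑ j, ξ_j ⊗ y_j` to `∑ j, ξ_j ⊗ V y_j`. -/
noncomputable def idTensor {n : ℕ} (V : QTensor d q n ≃ₗᵢ[ℂ] FTensor d n) :
    QTensor d q (n + 1) →ₗ[ℂ] FTensor d (n + 1) where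
  toFun x := WithLp.toLp 2 fun w => V (component (w 0) x) (Fin.tail w)
  map_add' x y := by
    ext w
    exact congrArg (fun z : FTensor d n => z (Fin.tail w))
      (map_add V (component (w 0) x) (component (w 0) y))
  map_smul' c x := by
    ext w
    exact congrArg (fun z : FTensor d n => z (Fin.tail w))
      (map_smul V c (component (w 0) x))

theorem norm_idTensor {n : ℕ} (V : QTensor d q n ≃ₗᵢ[ℂ] FTensor d n) (x : QTensor d q (n + 1)) :
    ‖idTensor V x‖ ^ 2 = ∑ j, ‖component j x‖ ^ 2 := by
  rw [EuclideanSpace.norm_sq_eq,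
    ← (Fin.consEquiv fun _ : Fin (n + 1) => Fin d).sum_comp, Fintype.sum_prod_type]
  refine Finset.sum_congr rfl fun j _ => ?_
  rw [← V.norm_map, EuclideanSpace.norm_sq_eq]
  simp [idTensor, Fin.consEquiv]

theorem sum_component {n : ℕ} (x : QTensor d q (n + 1)) :
    ∑ j, qCreateBlock d q j n (component j x) = x := by
  funext w
  have h : (∑ j, qCreateBlock d q j n (component j x)) w =
      ∑ j, (qCreateBlock d q j n (component j x)) w := Finset.sum_apply _ _ _
  rw [h]
  simp [qCreateBlock_apply, consMap, component]

theorem component_qM {n : ℕ} (j : Fin d) (x : QTensor d q (n + 1)) :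
    component j (qM d q n x) = ContinuousLinearMap.adjoint (qCreateBlock d q j n) x := by
  funext v
  have h : component j (qM d q n x) v = ∑ i, (qCreateBlock d q i n
      (ContinuousLinearMap.adjoint (qCreateBlock d q i n) x)) (Fin.cons j v) := by
    simp only [component, qM, sum_apply]
    exact Finset.sum_apply _ _ _
  rw [h]
  simp [qCreateBlock_apply, consMap]

theorem qM_nonneg (n : ℕ) : 0 ≤ qM d q n :=
  Finset.sum_nonneg fun j _ => by
    rw [ContinuousLinearMap.nonneg_iff_isPositive]
    exact ContinuousLinearMap.isPositive_self_comp_adjoint _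

theorem qM_injective (n : ℕ) : Function.Injective (qM d q n) := by
  rw [injective_iff_map_eq_zero]
  intro x hx
  have h : ∀ j, ContinuousLinearMap.adjoint (qCreateBlock d q j n) x = 0 := fun j => by
    rw [← component_qM, hx]; rfl
  rw [← @inner_self_eq_zero ℂ]
  nth_rw 1 [← sum_component x]
  rw [sum_inner]
  refine Finset.sum_eq_zero fun j _ => ?_
  rw [← ContinuousLinearMap.adjoint_inner_right, h, inner_zero_right]

theorem norm_idTensor_sqrt {n : ℕ} (V : QTensor d q n ≃ₗᵢ[ℂ] FTensor d n)
    (x : QTensor d q (n + 1)) : ‖idTensor V (CFC.sqrt (qM d q n) x)‖ = ‖x‖ := by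
  have hR : ∀ y, CFC.sqrt (qM d q n) (CFC.sqrt (qM d q n) y) = qM d q n y := fun y =>
    congrArg (fun T : QTensor d q (n + 1) →L[ℂ] QTensor d q (n + 1) => T y)
      (CFC.sqrt_mul_sqrt_self (qM d q n) (qM_nonneg n))
  have hsymm : ∀ y z, inner ℂ (CFC.sqrt (qM d q n) y) z = inner ℂ y (CFC.sqrt (qM d q n) z) := by
    have := (CFC.sqrt_nonneg (qM d q n))
    rw [ContinuousLinearMap.nonneg_iff_isPositive] at this
    exact this.isSymmetric
  have hsurj : Function.Surjective (qM d q n) :=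
    LinearMap.surjective_of_injective (f := (qM d q n).toLinearMap) (qM_injective n)
  obtain ⟨c, hc⟩ := hsurj x
  obtain ⟨b, rfl⟩ : ∃ b, x = CFC.sqrt (qM d q n) b := ⟨CFC.sqrt (qM d q n) c, by rw [hR, hc]⟩
  rw [← sq_eq_sq₀ (norm_nonneg _) (norm_nonneg _), norm_idTensor]
  have key : ∑ j, inner ℂ (component j (CFC.sqrt (qM d q n) (CFC.sqrt (qM d q n) b)))
      (component j (qM d q n b)) =
      inner ℂ (CFC.sqrt (qM d q n) b) (CFC.sqrt (qM d q n) b) := by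
    simp_rw [component_qM]
    have h1 : ∀ j, inner ℂ (component j (CFC.sqrt (qM d q n) (CFC.sqrt (qM d q n) b)))
        (ContinuousLinearMap.adjoint (qCreateBlock d q j n) b) =
        inner ℂ (qCreateBlock d q j n (component j (CFC.sqrt (qM d q n) (CFC.sqrt (qM d q n) b)))) b :=
      fun j => by
        rw [ContinuousLinearMap.adjoint_inner_right]
    rw [Finset.sum_congr rfl fun j _ => h1 j]
    rw [← sum_inner, sum_component, hsymm]
  rw [← hR] at key
  have h2 : ∀ {m : ℕ} (y : QTensor d q m), inner ℂ y y = ((‖y‖ ^ 2 : ℝ) : ℂ) := fun y => by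
    rw [inner_self_eq_norm_sq_to_K]; push_cast; rfl
  rw [Finset.sum_congr rfl fun j _ => h2 _, h2] at key
  exact_mod_cast key

theorem norm_toLp_zero (x : QTensor d q 0) :
    ‖(WithLp.linearEquiv 2 ℂ ((Fin 0 → Fin d) → ℂ)).symm (qCoord d q 0 x)‖ = ‖x‖ := by
  have h : form q.1 (qCoord d q 0 x) (qCoord d q 0 x) = ((‖qCoord d q 0 x default‖ ^ 2 : ℝ) : ℂ) := by
    simp [form, gram, invCount, Complex.conj_mul']
  have h1 : ‖x‖ ^ 2 = ‖qCoord d q 0 x default‖ ^ 2 := by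
    rw [← @inner_self_eq_norm_sq ℂ]
    exact congrArg Complex.re h
  rw [← sq_eq_sq₀ (norm_nonneg _) (norm_nonneg _), EuclideanSpace.norm_sq_eq, h1]
  simp

theorem finrank_eq (d : ℕ) (q : Set.Ioo (-1 : ℝ) 1) (n : ℕ) :
    Module.finrank ℂ (QTensor d q n) = Module.finrank ℂ (FTensor d n) :=
  (WithLp.linearEquiv 2 ℂ ((Fin n → Fin d) → ℂ)).finrank_eq.symm

variable (d q)

/-- The blocks of the unitary of Dykema and Nica: `U_0 Ω = Ω` and
`U_{n+1} = (I ⊗ U_n) M_{n+1}^{1/2}`. -/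
noncomputable def dnBlock : ∀ n, QTensor d q n ≃ₗᵢ[ℂ] FTensor d n
  | 0 =>
    { toLinearEquiv := (qCoord d q 0).trans (WithLp.linearEquiv 2 ℂ ((Fin 0 → Fin d) → ℂ)).symm
      norm_map' := norm_toLp_zero }
  | n + 1 => LinearIsometry.toLinearIsometryEquiv
      { toLinearMap := idTensor (dnBlock n) ∘ₗ (CFC.sqrt (qM d q n)).toLinearMap
        norm_map' := norm_idTensor_sqrt (dnBlock n) } (finrank_eq d q (n + 1))

/-- The unitary `U` of Dykema and Nica, the direct sum of the `U_n`. -/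
noncomputable def dnUnitary : QFockSpace d q ≃ₗᵢ[ℂ] FockSpace d := sumUnitary (dnBlock d q)

/-- The unitary `J U J_q`, where `J_q` and `J` are the reversals on the deformed and on the full
Fock space. -/
noncomputable def Uopp : QFockSpace d q ≃ₗᵢ[ℂ] FockSpace d :=
  ((qReverse d q).trans (dnUnitary d q)).trans (reverse d)

end

end QFock

/-!
Reversal turns left creation into right creation, so `Uopp L_j Uopp*` has degree one and, up to
reversal, its blocks are `U_{n+1} R_j U_n*`, with `R_j x = x ⊗ ξ_j` on the deformed spaces. The
recursion `U_{n+1} = (I ⊗ U_n) M_{n+1}^{1/2}` gives (with the extra tensor factor on the left,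
before the outer reversal is applied)

`U_{n+1} R_j U_n* - I ⊗ (U_n R_j U_{n-1}*) = (I ⊗ U_n) (M_{n+1}^{1/2} R_j - R_j M_n^{1/2}) U_n*`.

The right-hand side is exponentially small in `n`, for three reasons.

* On coordinates `M` is the sum of the `q ^ m` times the cycles that insert the first letter of a
  word in position `m`. Only the last of these cycles moves the last letter, whence
  `M_{n+1} R_j - R_j M_n = q ^ n L_j` (`qM_qCreateRight`).
* The `M_n` are bounded below uniformly in `n` and for every `|q| < 1`
  (`exists_pos_le_inner_sqrt_qM`). This rests on Zagier's factorization of the sum of cycles in the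
  group algebra (`sum_smul_mul_one_sub`), which bounds the inverse of `M_n` in any
  permutation-invariant norm, and hence bounds its eigenvalues.
* The commutator `X` of `R_j` with the square roots solves the Sylvester equation
  `M^{1/2} X + X M^{1/2} = M R_j - R_j M`, so that the lower bound makes `X` as small as the
  commutator with `M` (`norm_le_of_sylvester`). The factor `I ⊗ U_n` is bounded because
  `(I ⊗ U_n) M^{1/2}` is unitary (`norm_idTensor_le`).

So the blocks `A n` of `Uopp L_j Uopp*` satisfy `∑ ‖A (n + 1) - A n ⊗ I‖ < ∞`. The operator is then
the norm-convergent sum of the operators that apply `A (n + 1) - A n ⊗ I` to the first `n + 1`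
tensor factors, and each of these is a polynomial in the creation operators and their adjoints
(`stretch_mem_cuntz`, `mem_cuntz_of_summable`).
-/

namespace QFock

/-! ### Operators on finite-dimensional Hilbert spaces -/

section Hilbert

variable {H K : Type*} [NormedAddCommGroup H] [InnerProductSpace ℂ H] [FiniteDimensional ℂ H]
  [NormedAddCommGroup K] [InnerProductSpace ℂ K] [FiniteDimensional ℂ K]

theorem mul_norm_sq_le_inner_of_eigenvalue {S : H →ₗ[ℂ] H} (hS : S.IsSymmetric) {r : ℝ}
    (hr : ∀ (μ : ℝ) (x : H), x ≠ 0 → S x = (μ : ℂ) • x → r ≤ μ) (z : H) :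
    r * ‖z‖ ^ 2 ≤ (inner ℂ z (S z)).re := by
  have hn : Module.finrank ℂ H = Module.finrank ℂ H := rfl
  have hz : ∑ i, ‖inner ℂ (hS.eigenvectorBasis hn i) z‖ ^ 2 = ‖z‖ ^ 2 :=
    (hS.eigenvectorBasis hn).sum_sq_norm_inner_right z
  rw [← (hS.eigenvectorBasis hn).sum_inner_mul_inner, ← hz, Finset.mul_sum, Complex.re_sum]
  refine Finset.sum_le_sum fun i _ => ?_
  have h1 : inner ℂ (hS.eigenvectorBasis hn i) (S z) =
      (hS.eigenvalues hn i : ℂ) * inner ℂ (hS.eigenvectorBasis hn i) z := by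
    rw [← hS, hS.apply_eigenvectorBasis hn, inner_smul_left]
    simp
  have h2 : inner ℂ z (hS.eigenvectorBasis hn i) * inner ℂ (hS.eigenvectorBasis hn i) (S z) =
      ((hS.eigenvalues hn i * ‖inner ℂ (hS.eigenvectorBasis hn i) z‖ ^ 2 : ℝ) : ℂ) := by
    rw [h1, ← inner_conj_symm]
    push_cast
    rw [← Complex.conj_mul']
    ring
  rw [h2, Complex.ofReal_re]
  gcongr
  exact hr _ _ (norm_ne_zero_iff.1 (by rw [(hS.eigenvectorBasis hn).norm_eq_one]; exact one_ne_zero))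
    (hS.apply_eigenvectorBasis hn i)

omit [FiniteDimensional ℂ H] in
theorem norm_ge_of_mul_norm_sq_le_inner {S : H →L[ℂ] H} {r : ℝ}
    (hr : ∀ z, r * ‖z‖ ^ 2 ≤ (inner ℂ z (S z)).re) (z : H) : r * ‖z‖ ≤ ‖S z‖ := by
  rcases eq_or_ne z 0 with rfl | hz
  · simp
  have h1 : r * ‖z‖ ^ 2 ≤ ‖z‖ * ‖S z‖ :=
    (hr z).trans ((Complex.re_le_norm _).trans (norm_inner_le_norm z (S z)))
  have h2 : 0 < ‖z‖ := norm_pos_iff.2 hz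
  exact le_of_mul_le_mul_left (by linarith) h2

/-- A quantitative bound for the solution of the Sylvester equation `S X + X R = Y` with `S` and
`R` bounded below by `r`. It is tested on a vector `v` at which `X` attains its norm, so that
`X* X v = ‖X‖² v`. -/
theorem norm_le_of_sylvester {S : H →L[ℂ] H} {R : K →L[ℂ] K} {r : ℝ} (hr : 0 ≤ r)
    (hS : ∀ z, r * ‖z‖ ^ 2 ≤ (inner ℂ z (S z)).re)
    (hR : ∀ z, r * ‖z‖ ^ 2 ≤ (inner ℂ z (R z)).re)
    (X : K →L[ℂ] H) {C : ℝ} (hC : 0 ≤ C) (hY : ∀ z, ‖S (X z) + X (R z)‖ ≤ C * ‖z‖) (z : K) :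
    2 * r * ‖X z‖ ≤ C * ‖z‖ := by
  have := FiniteDimensional.proper_rclike ℂ K
  have := FiniteDimensional.complete ℂ H
  have := FiniteDimensional.complete ℂ K
  obtain ⟨v, hv, hmax⟩ := (isCompact_closedBall (0 : K) 1).exists_isMaxOn
    ⟨0, by simp⟩ (f := fun v => ‖X v‖) (by fun_prop)
  rw [mem_closedBall_zero_iff] at hv
  have hX : ‖X‖ ≤ ‖X v‖ := by
    refine X.opNorm_le_of_unit_norm (norm_nonneg _) fun x hx => ?_
    exact hmax (mem_closedBall_zero_iff.2 hx.le)
  rcases (norm_nonneg (X v)).eq_or_lt with h0 | hpos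
  · rw [← h0] at hX
    rw [norm_le_zero_iff.1 hX]
    simpa using by positivity
  have hadj : ContinuousLinearMap.adjoint X (X v) = ((‖X v‖ ^ 2 : ℝ) : ℂ) • v := by
    have e1 : ‖ContinuousLinearMap.adjoint X (X v)‖ ≤ ‖X v‖ * ‖X v‖ :=
      ContinuousLinearMap.le_of_opNorm_le _ (by rwa [LinearIsometryEquiv.norm_map]) _
    have e2 := @norm_sub_sq ℂ _ _ _ _ (ContinuousLinearMap.adjoint X (X v))
      (((‖X v‖ ^ 2 : ℝ) : ℂ) • v)
    have e3 : RCLike.re (inner ℂ (ContinuousLinearMap.adjoint X (X v))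
        (((‖X v‖ ^ 2 : ℝ) : ℂ) • v)) = ‖X v‖ ^ 2 * ‖X v‖ ^ 2 := by
      rw [inner_smul_right, ContinuousLinearMap.adjoint_inner_left, inner_self_eq_norm_sq_to_K]
      norm_cast
      exact Complex.re_ofReal_mul _ ((‖X v‖ ^ 2 : ℝ) : ℂ)
    rw [e3, norm_smul, Complex.norm_real, Real.norm_of_nonneg (by positivity)] at e2
    rw [← sub_eq_zero, ← norm_eq_zero, ← sq_eq_zero_iff]
    refine le_antisymm ?_ (by positivity)
    rw [e2]
    have e4 := pow_le_pow_left₀ (norm_nonneg _) e1 2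
    have e5 : (‖X v‖ ^ 2 * ‖v‖) ^ 2 ≤ (‖X v‖ ^ 2) ^ 2 :=
      pow_le_pow_left₀ (by positivity) (mul_le_of_le_one_right (by positivity) hv) 2
    nlinarith
  have hv1 : 1 ≤ ‖v‖ := by
    have := X.le_of_opNorm_le hX v
    by_contra hc
    push Not at hc
    nlinarith
  have hlow : ‖X v‖ ^ 2 * (2 * r) ≤ (inner ℂ (X v) (S (X v) + X (R v))).re := by
    rw [inner_add_right, ← ContinuousLinearMap.adjoint_inner_left X, hadj, inner_smul_left,
      Complex.conj_ofReal, Complex.add_re, Complex.re_ofReal_mul]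
    have e1 := hS (X v)
    have e2 := hR v
    have e3 : r ≤ (inner ℂ v (R v)).re :=
      le_trans (le_mul_of_one_le_right hr (one_le_pow₀ hv1)) e2
    nlinarith [sq_nonneg ‖X v‖]
  have hup : (inner ℂ (X v) (S (X v) + X (R v))).re ≤ ‖X v‖ * C :=
    (Complex.re_le_norm _).trans ((norm_inner_le_norm _ _).trans
      (mul_le_mul_of_nonneg_left ((hY v).trans (mul_le_of_le_one_right hC hv)) (norm_nonneg _)))
  have hfin : 2 * r * ‖X v‖ ≤ C := le_of_mul_le_mul_left (by linarith) hpos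
  calc 2 * r * ‖X z‖ ≤ 2 * r * (‖X v‖ * ‖z‖) := by
        gcongr
        exact X.le_of_opNorm_le hX z
    _ = 2 * r * ‖X v‖ * ‖z‖ := by ring
    _ ≤ _ := by gcongr

end Hilbert

/-! ### Sums of cycles -/

section Cycles

/-- Zagier's factorization. For the cycles `C k = (0 1 … k)` and `s = (0 1)` the sum
`β m = ∑ k ≤ m, q ^ k C_k` satisfies
`β (m + 1) (1 - q ^ (m + 1) C_{m + 1}) = (1 - q ^ (m + 2) s C_{m + 1}) β m`. -/
theorem sum_smul_mul_one_sub {R A : Type*} [CommRing R] [Ring A] [Algebra R A] (q : R)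
    (C : ℕ → A) (s : A) (m : ℕ) (h0 : C 0 = 1)
    (h : ∀ k ≤ m, C (k + 1) * C (m + 1) = s * C (m + 1) * C k) :
    (∑ k ∈ Finset.range (m + 2), q ^ k • C k) * (1 - q ^ (m + 1) • C (m + 1)) =
      (1 - q ^ (m + 2) • (s * C (m + 1))) * ∑ k ∈ Finset.range (m + 1), q ^ k • C k := by
  have h1 : (∑ k ∈ Finset.range (m + 2), q ^ k • C k) * C (m + 1) =
      C (m + 1) + q • (s * C (m + 1) * ∑ k ∈ Finset.range (m + 1), q ^ k • C k) := by
    rw [Finset.sum_range_succ', add_mul, h0, pow_zero, one_smul, one_mul, add_comm, Finset.sum_mul,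
      Finset.mul_sum, Finset.smul_sum]
    congr 1
    refine Finset.sum_congr rfl fun k hk => ?_
    rw [smul_mul_assoc, h k (by simp at hk; omega), mul_smul_comm, smul_smul, pow_succ']
  rw [mul_sub, mul_one, mul_smul_comm, h1, Finset.sum_range_succ, sub_mul, one_mul, smul_add,
    smul_smul, ← pow_succ, smul_mul_assoc]
  abel

/-- By the factorization, the lower bound for `β n` loses at each step only the factor
`(1 - |q| ^ (k + 2)) / (1 + |q| ^ (k + 1))`, when the `C k` and `s` are contractions. -/
theorem norm_le_prod_mul_norm_sum {E : Type*} [NormedAddCommGroup E] [NormedSpace ℂ E]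
    [FiniteDimensional ℂ E] {q : ℂ} (hq : ‖q‖ < 1) (C : ℕ → Module.End ℂ E) (s : Module.End ℂ E)
    (h0 : C 0 = 1) (hCn : ∀ k x, ‖C k x‖ ≤ ‖x‖) (hs : ∀ x, ‖s x‖ ≤ ‖x‖) (n : ℕ)
    (h : ∀ m < n, ∀ k ≤ m, C (k + 1) * C (m + 1) = s * C (m + 1) * C k) (y : E) :
    ‖y‖ ≤ (∏ k ∈ Finset.range n, (1 + ‖q‖ ^ (k + 1)) / (1 - ‖q‖ ^ (k + 2))) *
      ‖(∑ k ∈ Finset.range (n + 1), q ^ k • C k) y‖ := by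
  have hpow : ∀ k, ‖q‖ ^ (k + 1) < 1 := fun k => pow_lt_one₀ (norm_nonneg _) hq (by omega)
  have hlow : ∀ (T : Module.End ℂ E) (k : ℕ), (∀ x, ‖T x‖ ≤ ‖x‖) → ∀ x,
      (1 - ‖q‖ ^ k) * ‖x‖ ≤ ‖(1 - q ^ k • T) x‖ := by
    intro T k hT x
    have h1 := norm_sub_norm_le x (q ^ k • T x)
    rw [norm_smul, norm_pow] at h1
    have h2 := mul_le_mul_of_nonneg_left (hT x) (pow_nonneg (norm_nonneg q) k)
    simp only [LinearMap.sub_apply, Module.End.one_apply, LinearMap.smul_apply]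
    linarith
  induction n generalizing y with
  | zero => simp [h0]
  | succ n ih =>
    have hinj : Function.Injective (1 - q ^ (n + 1) • C (n + 1) : Module.End ℂ E) := by
      rw [injective_iff_map_eq_zero]
      intro x hx
      have h1 := hlow (C (n + 1)) (n + 1) (hCn _) x
      rw [hx, norm_zero] at h1
      have h2 := hpow n
      exact norm_le_zero_iff.1 (nonpos_of_mul_nonpos_right h1 (by linarith))
    obtain ⟨x, rfl⟩ := LinearMap.surjective_of_injective hinj y
    have h1 : ‖(1 - q ^ (n + 1) • C (n + 1)) x‖ ≤ (1 + ‖q‖ ^ (n + 1)) * ‖x‖ := by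
      have h1 := norm_sub_le x (q ^ (n + 1) • C (n + 1) x)
      rw [norm_smul, norm_pow] at h1
      have h2 := mul_le_mul_of_nonneg_left (hCn (n + 1) x) (pow_nonneg (norm_nonneg q) (n + 1))
      simp only [LinearMap.sub_apply, Module.End.one_apply, LinearMap.smul_apply]
      linarith
    rw [← Module.End.mul_apply, sum_smul_mul_one_sub q C s n h0 (h n n.lt_succ_self),
      Module.End.mul_apply]
    have h2 := hlow (s * C (n + 1)) (n + 2) (fun x => (hs _).trans (hCn _ x))
      ((∑ k ∈ Finset.range (n + 1), q ^ k • C k) x)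
    have h3 := ih (fun m hm => h m (by omega)) x
    have h4 : 0 < 1 - ‖q‖ ^ (n + 2) := by linarith [hpow (n + 1)]
    have h5 : 0 ≤ ∏ k ∈ Finset.range n, (1 + ‖q‖ ^ (k + 1)) / (1 - ‖q‖ ^ (k + 2)) :=
      Finset.prod_nonneg fun k _ => div_nonneg (by positivity) (by linarith [hpow (k + 1)])
    rw [Finset.prod_range_succ]
    refine h1.trans ?_
    rw [← le_div_iff₀' h4] at h2
    calc _ ≤ (1 + ‖q‖ ^ (n + 1)) * ((∏ k ∈ Finset.range n, (1 + ‖q‖ ^ (k + 1)) /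
          (1 - ‖q‖ ^ (k + 2))) * (‖(1 - q ^ (n + 2) • (s * C (n + 1)))
          ((∑ k ∈ Finset.range (n + 1), q ^ k • C k) x)‖ / (1 - ‖q‖ ^ (n + 2)))) := by
          gcongr
          exact h3.trans (by gcongr)
      _ = _ := by ring

/-- The losses have a convergent product: each factor is at most `exp (2 (1 - a)⁻¹ a ^ k)`. -/
theorem prod_le_exp {a : ℝ} (h0 : 0 ≤ a) (h1 : a < 1) (n : ℕ) :
    ∏ k ∈ Finset.range n, (1 + a ^ (k + 1)) / (1 - a ^ (k + 2)) ≤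
      Real.exp (2 * (1 - a)⁻¹ ^ 2) := by
  have ha : 0 < 1 - a := by linarith
  have hi : 1 ≤ (1 - a)⁻¹ := (one_le_inv₀ ha).2 (by linarith)
  have hk : ∀ k, (1 + a ^ (k + 1)) / (1 - a ^ (k + 2)) ≤ Real.exp (2 * (1 - a)⁻¹ * a ^ k) := by
    intro k
    have e1 : a ^ (k + 1) ≤ a ^ k := pow_le_pow_of_le_one h0 h1.le (by omega)
    have e2 : a ^ (k + 2) ≤ a ^ k := pow_le_pow_of_le_one h0 h1.le (by omega)
    have e3 : a ^ (k + 2) ≤ a := by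
      simpa using pow_le_pow_of_le_one h0 h1.le (show 1 ≤ k + 2 by omega)
    have e4 : 0 ≤ a ^ k := pow_nonneg h0 k
    have e5 : 0 < 1 - a ^ (k + 2) := by linarith
    rw [two_mul, add_mul, Real.exp_add, div_eq_mul_inv]
    refine mul_le_mul ?_ ?_ (by positivity) (by positivity)
    · refine le_trans ?_ (Real.add_one_le_exp _)
      nlinarith
    · refine le_trans ?_ (Real.add_one_le_exp _)
      rw [inv_le_iff_one_le_mul₀ e5, ← mul_le_mul_iff_right₀ ha]
      field_simp
      nlinarith [pow_nonneg h0 (k + 2)]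
  calc _ ≤ ∏ k ∈ Finset.range n, Real.exp (2 * (1 - a)⁻¹ * a ^ k) :=
        Finset.prod_le_prod (fun k _ => div_nonneg (by positivity)
          (by linarith [pow_lt_one₀ h0 h1 (show k + 2 ≠ 0 by omega)])) fun k _ => hk k
    _ = Real.exp (2 * (1 - a)⁻¹ * ∑ k ∈ Finset.range n, a ^ k) := by
        rw [← Real.exp_sum, Finset.mul_sum]
    _ ≤ _ := by
        refine Real.exp_le_exp.2 ?_
        rw [pow_two, ← mul_assoc]
        gcongr
        rw [← one_div, le_div_iff₀ ha, geom_sum_mul_neg]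
        linarith [pow_nonneg h0 n]

/-- The operator on functions of words by which a permutation of the letters acts. -/
def permute (α : Type*) {N : ℕ} (π : Equiv.Perm (Fin N)) : Module.End ℂ ((Fin N → α) → ℂ) :=
  LinearMap.funLeft ℂ ℂ fun w => w ∘ π

theorem permute_mul (α : Type*) {N : ℕ} (π τ : Equiv.Perm (Fin N)) :
    permute α (π * τ) = permute α π * permute α τ := rfl

theorem norm_permute_le {α : Type*} [Fintype α] {N : ℕ} (π : Equiv.Perm (Fin N))
    (x : (Fin N → α) → ℂ) : ‖permute α π x‖ ≤ ‖x‖ :=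
  (pi_norm_le_iff_of_nonneg (norm_nonneg _)).2 fun w => norm_le_pi_norm x (w ∘ π)

theorem cycleRange_mul_cycleRange {n : ℕ} {k m : ℕ} (hm : m < n) (hk : k ≤ m) :
    Fin.cycleRange (⟨k + 1, by omega⟩ : Fin (n + 1)) *
        Fin.cycleRange (⟨m + 1, by omega⟩ : Fin (n + 1)) =
      Fin.cycleRange (⟨1, by omega⟩ : Fin (n + 1)) *
        Fin.cycleRange (⟨m + 1, by omega⟩ : Fin (n + 1)) *
        Fin.cycleRange (⟨k, by omega⟩ : Fin (n + 1)) := by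
  have hv : ∀ i j : Fin (n + 1), (Fin.cycleRange i j : ℕ) =
      if (j : ℕ) < i then (j : ℕ) + 1 else if (j : ℕ) = i then 0 else j := by
    intro i j
    rcases lt_trichotomy j i with h | h | h
    · rw [Fin.coe_cycleRange_of_lt h, if_pos (by omega)]
    · rw [Fin.cycleRange_of_eq h]; simp [h]
    · rw [Fin.cycleRange_of_gt h, if_neg (by omega), if_neg (by omega)]
  ext ⟨i, hi⟩
  simp only [Equiv.Perm.mul_apply, hv]
  rcases lt_trichotomy i k with h1 | h1 | h1 <;> rcases lt_trichotomy i (m + 1) with h2 | h2 | h2 <;>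
    grind

end Cycles

/-! ### The operators `M_n` -/

section Deformed

variable {d : ℕ} {q : Set.Ioo (-1 : ℝ) 1}

theorem qM_apply (n : ℕ) (x : QTensor d q (n + 1)) (w : Fin (n + 1) → Fin d) :
    qM d q n x w = ∑ m : Fin (n + 1), (q.1 : ℂ) ^ (m : ℕ) * x (w ∘ m.cycleRange) := by
  have h := congrFun (component_qM (w 0) x) (Fin.tail w)
  rw [adjoint_qCreateBlock] at h
  simp only [component, Fin.cons_self_tail, ann] at h
  rw [h]
  refine Finset.sum_congr rfl fun m _ => ?_
  rw [← Fin.cons_comp_cycleRange, Fin.cons_self_tail]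

/-- A lower bound for `M` that is uniform in the degree. It holds for the supremum norm of the
coordinates, in which permutations of the letters are contractions. -/
theorem norm_coord_le_mul_norm_qM (n : ℕ) (x : QTensor d q (n + 1)) :
    ‖qCoord d q (n + 1) x‖ ≤ Real.exp (2 * (1 - |q.1|)⁻¹ ^ 2) *
      ‖qCoord d q (n + 1) (qM d q n x)‖ := by
  have hq : ‖(q.1 : ℂ)‖ = |q.1| := by simp
  have hq1 : |q.1| < 1 := abs_lt.2 q.2
  let c : ℕ → Equiv.Perm (Fin (n + 1)) := fun k =>
    if h : k < n + 1 then (⟨k, h⟩ : Fin (n + 1)).cycleRange else 1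
  have hc : ∀ k (h : k < n + 1), c k = (⟨k, h⟩ : Fin (n + 1)).cycleRange := fun k h => dif_pos h
  have hM : qCoord d q (n + 1) (qM d q n x) = (∑ k ∈ Finset.range (n + 1),
      (q.1 : ℂ) ^ k • permute (Fin d) (c k)) (qCoord d q (n + 1) x) := by
    funext w
    have h1 : qCoord d q (n + 1) (qM d q n x) w = _ := qM_apply n x w
    rw [h1, LinearMap.sum_apply, Finset.sum_apply, Finset.sum_range]
    refine Finset.sum_congr rfl fun m _ => ?_
    rw [hc m m.2]
    rfl
  have h := norm_le_prod_mul_norm_sum (q := (q.1 : ℂ)) (by rwa [hq]) (fun k => permute (Fin d) (c k))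
    (permute (Fin d) (c 1)) (by
      rw [hc 0 (by omega), Fin.cycleRange_mk_zero]
      rfl) (fun k => norm_permute_le _) (norm_permute_le _) n (by
      intro m hm k hk
      rw [← permute_mul, ← permute_mul, ← permute_mul, hc _ (by omega), hc _ (by omega),
        hc _ (by omega), hc _ (by omega), cycleRange_mul_cycleRange hm hk])
    (qCoord d q (n + 1) x)
  rw [hM]
  rw [hq] at h
  exact h.trans (mul_le_mul_of_nonneg_right (prod_le_exp (abs_nonneg _) hq1 n) (norm_nonneg _))

theorem sqrt_qM_sqrt_qM (n : ℕ) (x : QTensor d q (n + 1)) :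
    CFC.sqrt (qM d q n) (CFC.sqrt (qM d q n) x) = qM d q n x :=
  congrArg (fun T : QTensor d q (n + 1) →L[ℂ] QTensor d q (n + 1) => T x)
    (CFC.sqrt_mul_sqrt_self (qM d q n) (qM_nonneg n))

/-- The square roots of the `M_n` are bounded below, uniformly in `n`. An eigenvector of the square
root is one of `M_n`, and the bound for the eigenvalue can be read off in any norm, so that the
supremum norm of the coordinates serves. -/
theorem exists_pos_le_inner_sqrt_qM (d : ℕ) (q : Set.Ioo (-1 : ℝ) 1) : ∃ r : ℝ, 0 < r ∧
    ∀ (n : ℕ) (z : QTensor d q (n + 1)),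
      r * ‖z‖ ^ 2 ≤ (inner ℂ z (CFC.sqrt (qM d q n) z)).re := by
  set K := Real.exp (2 * (1 - |q.1|)⁻¹ ^ 2) with hK
  have hK0 : 0 < K := Real.exp_pos _
  refine ⟨√K⁻¹, by positivity, fun n z => ?_⟩
  have hpos : (CFC.sqrt (qM d q n)).IsPositive := by
    rw [← ContinuousLinearMap.nonneg_iff_isPositive]
    exact CFC.sqrt_nonneg _
  refine mul_norm_sq_le_inner_of_eigenvalue (S := (CFC.sqrt (qM d q n)).toLinearMap)
    hpos.isSymmetric (fun μ x hx hμ => ?_) z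
  replace hμ : CFC.sqrt (qM d q n) x = (μ : ℂ) • x := hμ
  have hμ0 : 0 ≤ μ := by
    have h1 : 0 ≤ (inner ℂ x (CFC.sqrt (qM d q n) x)).re := hpos.re_inner_nonneg_right x
    rw [hμ, inner_smul_right, Complex.re_ofReal_mul] at h1
    have h2 : 0 < (inner ℂ x x).re := by
      rw [inner_self_eq_norm_sq_to_K]
      norm_cast
      exact pow_pos (norm_pos_iff.2 hx) 2
    exact nonneg_of_mul_nonneg_left h1 h2
  refine (Real.sqrt_le_left hμ0).2 ?_
  have h1 := norm_coord_le_mul_norm_qM n x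
  rw [← sqrt_qM_sqrt_qM, hμ, map_smul, hμ, smul_smul, map_smul, norm_smul, ← hK] at h1
  have h2 : 0 < ‖qCoord d q (n + 1) x‖ := by simpa using hx
  have h3 : ‖(μ : ℂ) * (μ : ℂ)‖ = μ ^ 2 := by
    rw [norm_mul, Complex.norm_real, Real.norm_of_nonneg hμ0, pow_two]
  rw [h3, ← mul_assoc] at h1
  rw [inv_le_iff_one_le_mul₀' hK0]
  exact le_of_mul_le_mul_right (by linarith) h2

/-- The deformed right creation operator `x ↦ x ⊗ ξ_j`, obtained from the left one by reversal. -/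
noncomputable def qCreateRight (j : Fin d) (n : ℕ) : QTensor d q n →L[ℂ] QTensor d q (n + 1) :=
  (qReverseBlock d q (n + 1) : QTensor d q (n + 1) →L[ℂ] QTensor d q (n + 1)) ∘L
    qCreateBlock d q j n ∘L (qReverseBlock d q n : QTensor d q n →L[ℂ] QTensor d q n)

theorem qCreateRight_apply (j : Fin d) (n : ℕ) (x : QTensor d q n) (w : Fin (n + 1) → Fin d) :
    qCreateRight j n x w = if w (Fin.last n) = j then x (Fin.init w) else 0 := by
  have h1 : qCreateRight j n x w = if (w ∘ Fin.rev) 0 = j then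
    x (Fin.tail (w ∘ Fin.rev) ∘ Fin.rev) else 0 := rfl
  have h2 : Fin.tail (w ∘ Fin.rev) ∘ Fin.rev = Fin.init w := by
    funext i
    simp [Fin.tail, Fin.init, Fin.rev_succ]
  rw [h1, h2, Function.comp_apply, Fin.rev_zero]

/-- The operator `M` commutes with right creation, up to an exponentially small term: the cycle that
moves the first letter to the end of the word is the only one that touches the last letter. -/
theorem qM_qCreateRight (j : Fin d) (n : ℕ) (x : QTensor d q (n + 1)) :
    qM d q (n + 1) (qCreateRight j (n + 1) x) =
      qCreateRight j (n + 1) (qM d q n x) + (q.1 : ℂ) ^ (n + 1) • qCreateBlock d q j (n + 1) x := by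
  funext w
  have h1 : ∀ (y z : QTensor d q (n + 2)) (c : ℂ), (y + c • z) w = y w + c * z w :=
    fun y z c => rfl
  rw [h1, qM_apply, Fin.sum_univ_castSucc]
  have hlt : ∀ (m : Fin (n + 1)) (i : Fin (n + 1)),
      m.castSucc.cycleRange i.castSucc = (m.cycleRange i).castSucc := by
    intro m i
    ext
    rcases lt_trichotomy i m with h | h | h
    · rw [Fin.coe_cycleRange_of_lt (by simpa using h), Fin.val_castSucc, Fin.val_castSucc,
        Fin.coe_cycleRange_of_lt h]
    · rw [Fin.cycleRange_of_eq (by rw [h]), Fin.cycleRange_of_eq h]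
      rfl
    · rw [Fin.cycleRange_of_gt (by simpa using h), Fin.cycleRange_of_gt h]
  congr 1
  · have hm : ∀ m : Fin (n + 1), (w ∘ m.castSucc.cycleRange) (Fin.last (n + 1)) = w (Fin.last _) ∧
        Fin.init (w ∘ m.castSucc.cycleRange) = Fin.init w ∘ m.cycleRange := by
      intro m
      refine ⟨by rw [Function.comp_apply, Fin.cycleRange_of_gt (Fin.castSucc_lt_last m)], ?_⟩
      funext i
      simp only [Fin.init, Function.comp_apply, hlt]
    rw [qCreateRight_apply]
    split_ifs with hj
    · rw [qM_apply]
      refine Finset.sum_congr rfl fun m _ => ?_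
      rw [qCreateRight_apply, (hm m).1, if_pos hj, (hm m).2]
      rfl
    · refine Finset.sum_eq_zero fun m _ => ?_
      rw [qCreateRight_apply, (hm m).1, if_neg hj, mul_zero]
  · rw [qCreateRight_apply, qCreateBlock_apply]
    have hi : Fin.init (w ∘ (Fin.last (n + 1)).cycleRange) = Fin.tail w := by
      funext i
      simp only [Fin.init, Fin.tail, Function.comp_apply]
      congr 1
      ext
      rw [Fin.coe_cycleRange_of_lt (Fin.castSucc_lt_last i)]
      simp
    rw [hi, Function.comp_apply, Fin.cycleRange_self, Fin.val_last]
    rfl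

end Deformed

/-! ### The unitary intertwines the creation operators up to summable terms -/

section Blocks

variable {d : ℕ} {q : Set.Ioo (-1 : ℝ) 1}

/-- The component `y_c` of a tensor `∑ c, y_c ⊗ ξ_c`. -/
def rightComponent {n : ℕ} (c : Fin d) (y : FTensor d (n + 1)) : FTensor d n :=
  WithLp.toLp 2 fun v => y (Fin.snoc v c : Fin (n + 1) → Fin d)

/-- The map `T ↦ T ⊗ I`, where `I` is the identity on one further tensor factor on the right. -/
noncomputable def ampliate {a b : ℕ} :
    (FTensor d a →L[ℂ] FTensor d b) →ₗ[ℂ] (FTensor d (a + 1) →L[ℂ] FTensor d (b + 1)) where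
  toFun T := LinearMap.toContinuousLinearMap
    { toFun := fun y => WithLp.toLp 2 fun w => T (rightComponent (w (Fin.last b)) y) (Fin.init w)
      map_add' := fun y z => by
        ext w
        exact congrArg (fun x : FTensor d b => x (Fin.init w))
          (map_add T (rightComponent (w (Fin.last b)) y) (rightComponent (w (Fin.last b)) z))
      map_smul' := fun c y => by
        ext w
        exact congrArg (fun x : FTensor d b => x (Fin.init w))
          (map_smul T c (rightComponent (w (Fin.last b)) y)) }
  map_add' _ _ := rfl
  map_smul' _ _ := rfl

theorem ampliate_apply {a b : ℕ} (T : FTensor d a →L[ℂ] FTensor d b) (y : FTensor d (a + 1))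
    (w : Fin (b + 1) → Fin d) :
    ampliate T y w = T (rightComponent (w (Fin.last b)) y) (Fin.init w) := rfl

theorem norm_sq_eq_sum_rightComponent {n : ℕ} (y : FTensor d (n + 1)) :
    ‖y‖ ^ 2 = ∑ c, ‖rightComponent c y‖ ^ 2 := by
  rw [EuclideanSpace.norm_sq_eq, ← (Fin.snocEquiv fun _ : Fin (n + 1) => Fin d).sum_comp,
    Fintype.sum_prod_type]
  refine Finset.sum_congr rfl fun c _ => ?_
  rw [EuclideanSpace.norm_sq_eq]
  rfl

theorem rightComponent_ampliate {a b : ℕ} (T : FTensor d a →L[ℂ] FTensor d b)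
    (y : FTensor d (a + 1)) (c : Fin d) :
    rightComponent c (ampliate T y) = T (rightComponent c y) := by
  ext v
  change ampliate T y (Fin.snoc v c : Fin (b + 1) → Fin d) = _
  rw [ampliate_apply, Fin.snoc_last, Fin.init_snoc]

theorem norm_ampliate_le {a b : ℕ} (T : FTensor d a →L[ℂ] FTensor d b) :
    ‖ampliate T‖ ≤ ‖T‖ := by
  refine ContinuousLinearMap.opNorm_le_bound _ (norm_nonneg _) fun y => ?_
  refine le_of_sq_le_sq ?_ (by positivity)
  rw [mul_pow, norm_sq_eq_sum_rightComponent, norm_sq_eq_sum_rightComponent y, Finset.mul_sum]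
  refine Finset.sum_le_sum fun c _ => ?_
  rw [rightComponent_ampliate, ← mul_pow]
  exact pow_le_pow_left₀ (norm_nonneg _) (T.le_opNorm _) 2

variable (d q)

/-- The reversal of tensors on the `n`-th piece of the full Fock space. -/
noncomputable def reverseBlock (n : ℕ) : FTensor d n ≃ₗᵢ[ℂ] FTensor d n :=
  LinearIsometryEquiv.piLpCongrLeft 2 ℂ ℂ (revWord d n)

/-- The blocks of the unitary `Uopp`. -/
noncomputable def oppBlock (n : ℕ) : QTensor d q n ≃ₗᵢ[ℂ] FTensor d n :=
  ((qReverseBlock d q n).trans (dnBlock d q n)).trans (reverseBlock d n)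

/-- The blocks of the image of a deformed left creation operator under conjugation by `Uopp`. -/
noncomputable def conjBlock (j : Fin d) (n : ℕ) : FTensor d n →L[ℂ] FTensor d (n + 1) :=
  (oppBlock d q (n + 1) : QTensor d q (n + 1) →L[ℂ] FTensor d (n + 1)) ∘L
    qCreateBlock d q j n ∘L ((oppBlock d q n).symm : FTensor d n →L[ℂ] QTensor d q n)

variable {d q}

theorem reverseBlock_apply {n : ℕ} (x : FTensor d n) (w : Fin n → Fin d) :
    reverseBlock d n x w = x (w ∘ Fin.rev) := rfl

theorem qReverseBlock_qReverseBlock {n : ℕ} (x : QTensor d q n) :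
    qReverseBlock d q n (qReverseBlock d q n x) = x := by
  funext w
  have h : qReverseBlock d q n (qReverseBlock d q n x) w = x ((w ∘ Fin.rev) ∘ Fin.rev) := rfl
  rw [h]
  congr 1
  funext i
  simp

theorem conjBlock_reverseBlock_dnBlock (j : Fin d) (n : ℕ) (x : QTensor d q n) :
    conjBlock d q j n (reverseBlock d n (dnBlock d q n x)) =
      reverseBlock d (n + 1) (dnBlock d q (n + 1) (qCreateRight j n x)) := by
  have h : reverseBlock d n (dnBlock d q n x) = oppBlock d q n (qReverseBlock d q n x) := by
    conv_lhs => rw [← qReverseBlock_qReverseBlock x]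
    rfl
  rw [h]
  change oppBlock d q (n + 1) (qCreateBlock d q j n ((oppBlock d q n).symm _)) = _
  rw [LinearIsometryEquiv.symm_apply_apply]
  rfl

theorem component_qCreateRight (c j : Fin d) (n : ℕ) (x : QTensor d q (n + 1)) :
    component c (qCreateRight j (n + 1) x) = qCreateRight j n (component c x) := by
  funext v
  have h : component c (qCreateRight j (n + 1) x) v =
    qCreateRight j (n + 1) x (Fin.cons c v) := rfl
  rw [h, qCreateRight_apply, qCreateRight_apply, ← Fin.succ_last, Fin.cons_succ]
  have h1 : Fin.init (Fin.cons c v : Fin (n + 2) → Fin d) =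
      (Fin.cons c (Fin.init v) : Fin (n + 1) → Fin d) := by
    funext i
    refine Fin.cases ?_ (fun i => ?_) i <;> simp [Fin.init]
  rw [h1]
  rfl

theorem ampliate_conjBlock (j : Fin d) (n : ℕ) (x : QTensor d q (n + 1)) :
    ampliate (conjBlock d q j n) (reverseBlock d (n + 1) (idTensor (dnBlock d q n) x)) =
      reverseBlock d (n + 2) (idTensor (dnBlock d q (n + 1)) (qCreateRight j (n + 1) x)) := by
  ext w
  rw [ampliate_apply, reverseBlock_apply]
  have h1 : ∀ c, rightComponent c (reverseBlock d (n + 1) (idTensor (dnBlock d q n) x)) =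
      reverseBlock d n (dnBlock d q n (component c x)) := by
    intro c
    ext v
    change idTensor (dnBlock d q n) x ((Fin.snoc v c : Fin (n + 1) → Fin d) ∘ Fin.rev) =
      dnBlock d q n (component c x) (v ∘ Fin.rev)
    rw [Fin.snoc_comp_rev]
    rfl
  have h2 : Fin.init w ∘ Fin.rev = Fin.tail (w ∘ Fin.rev) := by
    funext i
    simp [Fin.tail, Fin.init, Fin.rev_succ]
  rw [h1, conjBlock_reverseBlock_dnBlock, reverseBlock_apply, h2, ← component_qCreateRight,
    ← Fin.rev_zero]
  rfl

/-- The map `I ⊗ V` need not be contractive for the deformed norms, but `(I ⊗ V) M^{1/2}` is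
isometric and `M^{1/2}` is bounded below. -/
theorem norm_idTensor_le {r : ℝ} (hr : 0 < r) {n : ℕ}
    (hlow : ∀ z, r * ‖z‖ ^ 2 ≤ (inner ℂ z (CFC.sqrt (qM d q n) z)).re)
    (V : QTensor d q n ≃ₗᵢ[ℂ] FTensor d n) (z : QTensor d q (n + 1)) :
    ‖idTensor V z‖ ≤ r⁻¹ * ‖z‖ := by
  have e := norm_ge_of_mul_norm_sq_le_inner hlow
  have hinj : Function.Injective (CFC.sqrt (qM d q n)).toLinearMap := by
    rw [injective_iff_map_eq_zero]
    intro b hb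
    have h1 := e b
    have h2 : ‖CFC.sqrt (qM d q n) b‖ = 0 := norm_eq_zero.2 hb
    rw [h2] at h1
    exact norm_le_zero_iff.1 (nonpos_of_mul_nonpos_right h1 hr)
  obtain ⟨b, hb⟩ := LinearMap.surjective_of_injective hinj z
  replace hb : CFC.sqrt (qM d q n) b = z := hb
  rw [← hb, norm_idTensor_sqrt, le_inv_mul_iff₀ hr]
  exact e b

/-- Right creation almost commutes with the square roots of the `M_n` as well: the commutator
solves a Sylvester equation whose right-hand side is the commutator with `M`. -/
theorem norm_sqrt_qM_commutator_le {r : ℝ} (hr : 0 < r)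
    (hlow : ∀ (n : ℕ) (z : QTensor d q (n + 1)),
      r * ‖z‖ ^ 2 ≤ (inner ℂ z (CFC.sqrt (qM d q n) z)).re)
    (j : Fin d) (n : ℕ) (x : QTensor d q (n + 1)) :
    ‖CFC.sqrt (qM d q (n + 1)) (qCreateRight j (n + 1) x) -
        qCreateRight j (n + 1) (CFC.sqrt (qM d q n) x)‖ ≤
      (2 * r)⁻¹ * (|q.1| ^ (n + 1) * √(1 - |q.1|)⁻¹ * ‖x‖) := by
  rw [le_inv_mul_iff₀ (by positivity)]
  refine norm_le_of_sylvester hr.le (hlow (n + 1)) (hlow n)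
    (CFC.sqrt (qM d q (n + 1)) ∘L qCreateRight j (n + 1) -
      qCreateRight j (n + 1) ∘L CFC.sqrt (qM d q n)) (by positivity) (fun z => ?_) x
  simp only [sub_apply, ContinuousLinearMap.comp_apply, map_sub, sqrt_qM_sqrt_qM,
    qM_qCreateRight]
  rw [sub_add_sub_cancel, add_sub_cancel_left, norm_smul, norm_pow, Complex.norm_real,
    Real.norm_eq_abs, mul_assoc]
  gcongr
  exact ContinuousLinearMap.le_of_opNorm_le _ (norm_qCreateBlock_le j (n + 1)) z

/-- The blocks of `Uopp L_j Uopp*` stabilize exponentially fast. -/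
theorem exists_norm_conjBlock_sub_le (j : Fin d) : ∃ C : ℝ, ∀ n,
    ‖conjBlock d q j (n + 1) - ampliate (conjBlock d q j n)‖ ≤ C * |q.1| ^ n := by
  obtain ⟨r, hr, hlow⟩ := exists_pos_le_inner_sqrt_qM d q
  refine ⟨r⁻¹ * ((2 * r)⁻¹ * (|q.1| * √(1 - |q.1|)⁻¹)), fun n => ?_⟩
  refine ContinuousLinearMap.opNorm_le_bound _ (by positivity) fun y => ?_
  obtain ⟨x, rfl⟩ : ∃ x, y = reverseBlock d (n + 1) (dnBlock d q (n + 1) x) :=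
    ⟨(dnBlock d q (n + 1)).symm ((reverseBlock d (n + 1)).symm y), by simp⟩
  rw [LinearIsometryEquiv.norm_map, LinearIsometryEquiv.norm_map]
  have h1 : (conjBlock d q j (n + 1) - ampliate (conjBlock d q j n))
      (reverseBlock d (n + 1) (dnBlock d q (n + 1) x)) =
      reverseBlock d (n + 2) (idTensor (dnBlock d q (n + 1))
        (CFC.sqrt (qM d q (n + 1)) (qCreateRight j (n + 1) x) -
        qCreateRight j (n + 1) (CFC.sqrt (qM d q n) x))) := by
    rw [sub_apply, conjBlock_reverseBlock_dnBlock]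
    have e : dnBlock d q (n + 1) x = idTensor (dnBlock d q n) (CFC.sqrt (qM d q n) x) := rfl
    rw [e, ampliate_conjBlock, ← map_sub, map_sub (idTensor (dnBlock d q (n + 1)))]
    rfl
  rw [h1, LinearIsometryEquiv.norm_map]
  refine (norm_idTensor_le hr (hlow (n + 1)) _ _).trans ?_
  calc _ ≤ r⁻¹ * ((2 * r)⁻¹ * (|q.1| ^ (n + 1) * √(1 - |q.1|)⁻¹ * ‖x‖)) :=
        mul_le_mul_of_nonneg_left (norm_sqrt_qM_commutator_le hr hlow j n x) (by positivity)
    _ = _ := by ring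

end Blocks

/-! ### Operators of the Cuntz algebra -/

section Stretch

variable {d : ℕ}

theorem createBlock_apply (j : Fin d) (n : ℕ) (x : FTensor d n) (w : Fin (n + 1) → Fin d) :
    createBlock d j n x w = if w 0 = j then x (Fin.tail w) else 0 := rfl

theorem adjoint_createBlock_apply (j : Fin d) (n : ℕ) (y : FTensor d (n + 1))
    (v : Fin n → Fin d) :
    ContinuousLinearMap.adjoint (createBlock d j n) y v =
      y (Fin.cons j v : Fin (n + 1) → Fin d) := by
  have h : ContinuousLinearMap.adjoint (createBlock d j n) y =
      WithLp.toLp 2 fun v => y (Fin.cons j v : Fin (n + 1) → Fin d) := by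
    refine ext_inner_left ℂ fun x => ?_
    rw [ContinuousLinearMap.adjoint_inner_right, PiLp.inner_apply, PiLp.inner_apply,
      ← (Fin.consEquiv fun _ : Fin (n + 1) => Fin d).sum_comp, Fintype.sum_prod_type,
      Finset.sum_eq_single j]
    · simp [createBlock_apply, Fin.consEquiv]
    · intro b _ hb; simp [createBlock_apply, Fin.consEquiv, hb]
    · simp
  rw [h]

theorem sum_createBlock_adjoint (n : ℕ) (y : FTensor d (n + 1)) :
    ∑ j, createBlock d j n (ContinuousLinearMap.adjoint (createBlock d j n) y) = y := by
  ext w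
  simp [createBlock_apply, adjoint_createBlock_apply, Finset.sum_apply]

theorem ampliate_createBlock (j : Fin d) (n : ℕ) :
    ampliate (createBlock d j n) = createBlock d j (n + 1) := by
  ext y w
  rw [ampliate_apply, createBlock_apply, createBlock_apply]
  have h : (Fin.snoc (Fin.tail (Fin.init w)) (w (Fin.last (n + 1))) : Fin (n + 1) → Fin d) =
      Fin.tail w := by
    rw [Fin.tail_init_eq_init_tail]
    exact Fin.snoc_init_self (Fin.tail w)
  have h0 : Fin.init w 0 = w 0 := rfl
  rw [h0, ← h]
  rfl

theorem ampliate_createBlock_comp (i j : Fin d) {a b : ℕ} (X : FTensor d a →L[ℂ] FTensor d b) :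
    ampliate (createBlock d i b ∘L X ∘L ContinuousLinearMap.adjoint (createBlock d j a)) =
      createBlock d i (b + 1) ∘L ampliate X ∘L
        ContinuousLinearMap.adjoint (createBlock d j (a + 1)) := by
  ext y w
  rw [ampliate_apply, ContinuousLinearMap.comp_apply, ContinuousLinearMap.comp_apply,
    ContinuousLinearMap.comp_apply, ContinuousLinearMap.comp_apply, createBlock_apply,
    createBlock_apply, ampliate_apply, Fin.tail_init_eq_init_tail]
  have h : ∀ c, ContinuousLinearMap.adjoint (createBlock d j a) (rightComponent c y) =
      rightComponent c (ContinuousLinearMap.adjoint (createBlock d j (a + 1)) y) := by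
    intro c
    ext v
    have e : rightComponent c (ContinuousLinearMap.adjoint (createBlock d j (a + 1)) y) v =
      ContinuousLinearMap.adjoint (createBlock d j (a + 1)) y
        (Fin.snoc v c : Fin (a + 1) → Fin d) := rfl
    rw [e, adjoint_createBlock_apply, adjoint_createBlock_apply, Fin.cons_snoc_eq_snoc_cons]
    rfl
  rw [h]
  rfl

/-- The blocks of `D n ⊗ I`: zero in degrees below `n`, and `D n ⊗ I ⊗ ⋯ ⊗ I` with `m - n` factors
`I` in degree `m ≥ n`. -/
noncomputable def stretchBlock (D : ∀ n, FTensor d n →L[ℂ] FTensor d (n + 1)) (n : ℕ) :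
    ∀ m, FTensor d m →L[ℂ] FTensor d (m + 1)
  | 0 => if n = 0 then D 0 else 0
  | m + 1 => if n = m + 1 then D (m + 1) else ampliate (stretchBlock D n m)

theorem norm_stretchBlock_le (D : ∀ n, FTensor d n →L[ℂ] FTensor d (n + 1)) (n m : ℕ) :
    ‖stretchBlock D n m‖ ≤ ‖D n‖ := by
  induction m with
  | zero =>
    rw [stretchBlock]
    split_ifs with h
    · rw [h]
    · simp
  | succ m ih =>
    rw [stretchBlock]
    split_ifs with h
    · rw [h]
    · exact (norm_ampliate_le _).trans ih

theorem stretchBlock_of_lt (D : ∀ n, FTensor d n →L[ℂ] FTensor d (n + 1)) {n m : ℕ} (h : m < n) :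
    stretchBlock D n m = 0 := by
  induction m with
  | zero => rw [stretchBlock, if_neg (by omega)]
  | succ m ih => rw [stretchBlock, if_neg (by omega), ih (by omega), map_zero]

/-- The operator on the full Fock space that applies `D n` to the first `n` tensor factors, and
kills the tensors of smaller degree. -/
noncomputable def stretch (D : ∀ n, FTensor d n →L[ℂ] FTensor d (n + 1)) (n : ℕ) :
    FockSpace d →L[ℂ] FockSpace d :=
  raise (stretchBlock D n) ‖D n‖ (norm_stretchBlock_le D n)

theorem norm_stretch_le (D : ∀ n, FTensor d n →L[ℂ] FTensor d (n + 1)) (n : ℕ) :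
    ‖stretch D n‖ ≤ ‖D n‖ :=
  by
  unfold stretch raise
  exact LinearMap.mkContinuous_norm_le _ (norm_nonneg _) _

theorem stretch_apply (D : ∀ n, FTensor d n →L[ℂ] FTensor d (n + 1)) (n : ℕ) (x : FockSpace d)
    (m : ℕ) : stretch D n x m = raiseFun (stretchBlock D n) x m := rfl

theorem create_apply (j : Fin d) (x : FockSpace d) (m : ℕ) :
    create d j x m = raiseFun (createBlock d j) x m := rfl

theorem adjoint_create_apply (j : Fin d) (x : FockSpace d) (m : ℕ) :
    ContinuousLinearMap.adjoint (create d j) x m =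
      ContinuousLinearMap.adjoint (createBlock d j m) (x (m + 1)) := by
  refine ext_inner_left ℂ fun v => ?_
  rw [← lp.inner_single_left, ContinuousLinearMap.adjoint_inner_right,
    ContinuousLinearMap.adjoint_inner_right, ← lp.inner_single_left]
  congr 1
  ext1
  funext k
  rw [create_apply]
  cases k with
  | zero => rw [lp.single_apply_ne _ _ _ (by omega)]; rfl
  | succ k =>
    rw [raiseFun]
    by_cases h : k = m
    · subst h
      rw [lp.single_apply_self, lp.single_apply_self]
    · rw [lp.single_apply_ne _ _ _ h, lp.single_apply_ne _ _ _ (by omega), map_zero]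

theorem create_mem_cuntz (j : Fin d) : create d j ∈ cuntz d :=
  StarSubalgebra.le_topologicalClosure _ (StarAlgebra.subset_adjoin _ _ ⟨j, rfl⟩)

/-- The matrix coefficients of `D` with respect to the first letter, as maps of one degree less. -/
noncomputable def peel (D : ∀ n, FTensor d n →L[ℂ] FTensor d (n + 1)) (i j : Fin d) (n : ℕ) :
    FTensor d n →L[ℂ] FTensor d (n + 1) :=
  ContinuousLinearMap.adjoint (createBlock d i (n + 1)) ∘L D (n + 1) ∘L createBlock d j n

/-- In degree zero `D 0` is determined by the image of the vacuum, which is the constant function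
`1` on the one-element set of empty words. -/
theorem stretchBlock_zero (D : ∀ n, FTensor d n →L[ℂ] FTensor d (n + 1)) (m : ℕ) :
    stretchBlock D 0 m =
      ∑ j, D 0 (WithLp.toLp 2 fun _ => 1) (fun _ => j) • createBlock d j m := by
  induction m with
  | zero =>
    rw [stretchBlock, if_pos rfl]
    ext y w
    have hy : y = y default • WithLp.toLp 2 fun _ => 1 := by
      ext v
      simp [Subsingleton.elim v default]
    have hw : w = fun _ => w 0 := by
      funext i
      rw [Fin.fin_one_eq_zero i]
    have h1 : (∑ j, D 0 (WithLp.toLp 2 fun _ => 1) (fun _ => j) • createBlock d j 0) y w =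
        D 0 (WithLp.toLp 2 fun _ => 1) (fun _ => w 0) * y default := by
      simp [createBlock_apply, Finset.sum_apply, Subsingleton.elim (Fin.tail w) default]
    rw [h1, ← hw]
    conv_lhs => rw [hy, map_smul]
    simp [mul_comm]
  | succ m ih =>
    rw [stretchBlock, if_neg (by omega), ih, map_sum]
    exact Finset.sum_congr rfl fun j _ => by rw [map_smul, ampliate_createBlock]

theorem stretchBlock_succ (D : ∀ n, FTensor d n →L[ℂ] FTensor d (n + 1)) (n m : ℕ) :
    stretchBlock D (n + 1) (m + 1) = ∑ i, ∑ j, createBlock d i (m + 1) ∘L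
      stretchBlock (peel D i j) n m ∘L ContinuousLinearMap.adjoint (createBlock d j m) := by
  have key : ∀ m, D (m + 1) = ∑ i, ∑ j, createBlock d i (m + 1) ∘L
      peel D i j m ∘L ContinuousLinearMap.adjoint (createBlock d j m) := by
    intro m
    ext1 y
    simp only [sum_apply, ContinuousLinearMap.comp_apply, peel]
    simp_rw [← map_sum]
    rw [sum_createBlock_adjoint, sum_createBlock_adjoint]
  induction m with
  | zero =>
    rw [stretchBlock]
    split_ifs with h
    · obtain rfl : n = 0 := by omega
      simp only [stretchBlock, if_true]
      exact key 0
    · rw [stretchBlock_of_lt D (by omega), map_zero]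
      simp [stretchBlock, show n ≠ 0 by omega]
  | succ m ih =>
    rw [stretchBlock]
    split_ifs with h
    · obtain rfl : n = m + 1 := by omega
      simp only [stretchBlock, if_true]
      exact key (m + 1)
    · rw [ih]
      simp only [map_sum, ampliate_createBlock_comp]
      simp only [stretchBlock, show n ≠ m + 1 by omega, if_false]

theorem sum_fock_apply {ι : Type*} [Fintype ι] (x : ι → FockSpace d) (m : ℕ) :
    (∑ i, x i) m = ∑ i, x i m := by
  rw [lp.coeFn_sum, Finset.sum_apply]

theorem stretch_zero (D : ∀ n, FTensor d n →L[ℂ] FTensor d (n + 1)) :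
    stretch D 0 = ∑ j, D 0 (WithLp.toLp 2 fun _ => 1) (fun _ => j) • create d j := by
  ext1 x
  ext1
  funext m
  simp only [sum_apply, smul_apply, sum_fock_apply, lp.coeFn_smul, Pi.smul_apply, create_apply,
    stretch_apply]
  cases m with
  | zero => simp [raiseFun]
  | succ m => simp [raiseFun, stretchBlock_zero, sum_apply]

theorem stretch_succ (D : ∀ n, FTensor d n →L[ℂ] FTensor d (n + 1)) (n : ℕ) :
    stretch D (n + 1) =
      ∑ i, ∑ j, create d i * stretch (peel D i j) n * star (create d j) := by
  ext1 x
  ext1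
  funext m
  simp only [sum_apply, sum_fock_apply, mul_apply_eq_comp, create_apply]
  rw [stretch_apply]
  rcases m with _ | _ | m
  · simp [raiseFun]
  · simp [raiseFun, stretch_apply, stretchBlock_of_lt]
  · simp only [raiseFun, stretch_apply, ContinuousLinearMap.star_eq_adjoint, adjoint_create_apply,
      stretchBlock_succ, sum_apply, ContinuousLinearMap.comp_apply]

/-- Stretched operators are polynomials in the creation operators and their adjoints: letters are
split off on the left of `D n` until only a map from the vacuum to one-letter tensors remains. -/
theorem stretch_mem_cuntz (n : ℕ) (D : ∀ n, FTensor d n →L[ℂ] FTensor d (n + 1)) :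
    stretch D n ∈ cuntz d := by
  induction n generalizing D with
  | zero =>
    rw [stretch_zero]
    exact sum_mem fun j _ => (cuntz d).smul_mem (create_mem_cuntz j) _
  | succ n ih =>
    rw [stretch_succ]
    exact sum_mem fun i _ => sum_mem fun j _ =>
      mul_mem (mul_mem (create_mem_cuntz i) (ih _)) (star_mem (create_mem_cuntz j))

/-- An operator of degree one whose blocks `A n` stabilize at a summable rate, in the sense that
`A (n + 1)` is close to `A n ⊗ I`, is the sum of the stretched increments, and so lies in the Cuntz
algebra. -/
theorem mem_cuntz_of_summable (A : ∀ n, FTensor d n →L[ℂ] FTensor d (n + 1))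
    (hA : Summable fun n => ‖A (n + 1) - ampliate (A n)‖) (T : FockSpace d →L[ℂ] FockSpace d)
    (hT : ∀ x m, T x m = raiseFun A x m) : T ∈ cuntz d := by
  let D : ∀ n, FTensor d n →L[ℂ] FTensor d (n + 1) := fun n =>
    Nat.casesOn n (A 0) fun n => A (n + 1) - ampliate (A n)
  have hD : Summable fun n => ‖D n‖ := (summable_nat_add_iff 1).1 hA
  have hs : Summable (stretch D) := .of_norm_bounded hD (norm_stretch_le D)
  -- In degree `m` the increments `D n ⊗ I` with `n ≤ m` telescope to `A m`.
  have htel : ∀ m, ∑ n ∈ Finset.range (m + 1), stretchBlock D n m = A m := by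
    intro m
    induction m with
    | zero => simp [stretchBlock, D]
    | succ m ih =>
      have h1 : ∀ n ∈ Finset.range (m + 1),
          stretchBlock D n (m + 1) = ampliate (stretchBlock D n m) := fun n hn => by
        rw [stretchBlock, if_neg (by simp at hn; omega)]
      rw [Finset.sum_range_succ, Finset.sum_congr rfl h1, ← map_sum, ih, stretchBlock, if_pos rfl]
      exact add_sub_cancel _ _
  have hsum : ∑' n, stretch D n = T := by
    ext1 x
    ext1
    funext m
    have h1 : HasSum (fun n => stretch D n x m) ((∑' n, stretch D n) x m) :=
      (hs.hasSum.mapL (ContinuousLinearMap.apply ℂ (FockSpace d) x)).mapL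
        (lp.evalCLM ℂ (fun n => FTensor d n) (p := 2) m)
    refine h1.unique ?_
    rw [hT]
    cases m with
    | zero => exact hasSum_zero
    | succ m =>
      have h2 : raiseFun A x (m + 1) =
          ∑ n ∈ Finset.range (m + 1), stretch D n x (m + 1) := by
        rw [raiseFun, ← htel, sum_apply]
        rfl
      rw [h2]
      refine hasSum_sum_of_ne_finset_zero fun n hn => ?_
      rw [stretch_apply, raiseFun, stretchBlock_of_lt D (by simpa using hn), zero_apply]
  rw [← hsum]
  exact (StarSubalgebra.isClosed_topologicalClosure _).mem_of_tendsto hs.hasSum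
    (.of_forall fun s => sum_mem fun n _ => stretch_mem_cuntz n D)

end Stretch

/-! ### Conjugation by the unitary -/

theorem conj_mem_of_mem_closure_adjoin {H K : Type*} [NormedAddCommGroup H]
    [InnerProductSpace ℂ H] [CompleteSpace H] [NormedAddCommGroup K] [InnerProductSpace ℂ K]
    [CompleteSpace K] (e : H ≃ₗᵢ[ℂ] K) {s : Set (H →L[ℂ] H)} {B : StarSubalgebra ℂ (K →L[ℂ] K)}
    (hB : IsClosed (B : Set (K →L[ℂ] K))) (h : ∀ a ∈ s, e.conjStarAlgEquiv a ∈ B) {T : H →L[ℂ] H}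
    (hT : T ∈ (StarAlgebra.adjoin ℂ s).topologicalClosure) : e.conjStarAlgEquiv T ∈ B := by
  have hc : Continuous e.conjStarAlgEquiv :=
    (e.toContinuousLinearEquiv.conjContinuousAlgEquiv).continuous
  have hle : (StarAlgebra.adjoin ℂ s).topologicalClosure ≤
      B.comap (StarAlgHomClass.toStarAlgHom e.conjStarAlgEquiv) :=
    StarSubalgebra.topologicalClosure_minimal (StarAlgebra.adjoin_le_iff.2 h) (hB.preimage hc)
  exact hle hT

theorem conj_qCreate_mem_cuntz (d : ℕ) (q : Set.Ioo (-1 : ℝ) 1) (j : Fin d) :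
    (Uopp d q).conjStarAlgEquiv (qCreate d q j) ∈ cuntz d := by
  obtain ⟨C, hC⟩ := exists_norm_conjBlock_sub_le (q := q) j
  have hq : |q.1| < 1 := abs_lt.2 q.2
  refine mem_cuntz_of_summable (conjBlock d q j) (.of_nonneg_of_le (fun n => norm_nonneg _) hC
    ((summable_geometric_of_lt_one (abs_nonneg _) hq).mul_left C)) _ fun x m => ?_
  cases m with
  | zero => exact map_zero (oppBlock d q 0)
  | succ m => rfl

end QFock

theorem theorem1p3 (d : ℕ) (hd : 2 ≤ d) (q : Set.Ioo (-1 : ℝ) 1) :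
    ∀ T ∈ QFock.qCuntz d q,
      (QFock.Uopp d q : QFock.QFockSpace d q →L[ℂ] QFock.FockSpace d) ∘L T ∘L
        ContinuousLinearMap.adjoint
          (QFock.Uopp d q : QFock.QFockSpace d q →L[ℂ] QFock.FockSpace d) ∈ QFock.cuntz d := by
  intro T hT
  rw [LinearIsometryEquiv.adjoint_eq_symm]
  refine QFock.conj_mem_of_mem_closure_adjoin (QFock.Uopp d q)
    (StarSubalgebra.isClosed_topologicalClosure _) ?_ hT
  rintro _ ⟨j, rfl⟩
  exact QFock.conj_qCreate_mem_cuntz d q j
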